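/- **Theorem (Wigner–Eckart for $U_t(su(2))$).** Let $t$ be a real number, $t\neq 0,\pm1$, and let $U_t(su(2))$ be the complex Hopf algebra with generators $e,f,k^{\pm1}$, relations $kk^{-1}=k^{-1}k=1$, $ke=t^2ek$, $kf=t^{-2}fk$, $[e,f]=\dfrac{k^2-k^{-2}}{t^2-t^{-2}}$, coproduct $\Delta(k^{\pm1})=k^{\pm1}\otimes k^{\pm1}$, $\Delta(e)=e\otimes k^{-1}+k\otimes e$, $\Delta(f)=f\otimes k^{-1}+k\otimes f$, counit $\varepsilon(k^{\pm1})=1$, $\varepsilon(e)=\varepsilon(f)=0$ and antipode $S(k)=k^{-1}$, $S(e)=-t^{-2}e$, $S(f)=-t^2f$. For $l\in\{0,\frac12,1,\dots\}$ let $(V^l,\pi^l)$ be the irreducible representation on the complex space with weight basis $e^l_m$, $m=-l,\dots,l$, given by $$e\,e^l_m=([l-m][l+m+1])^{1/2}e^l_{m+1},\quad f\,e^l_m=([l+m][l-m+1])^{1/2}e^l_{m-1},\quad k^{\pm1}e^l_m=t^{\pm2m}e^l_m,\qquad [n]=\frac{t^{2n}-t^{-2n}}{t^2-t^{-2}}.$$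 Let $k,l,j\in\{0,\frac12,1,\dots\}$. There are isomorphisms of representations $V^k\otimes V^l\cong\bigoplus_{i=|k-l|}^{k+l}V^i$, where the algebra acts on the tensor product through $\Delta$. Given such an isomorphism, write $$e^k_p\otimes e^l_n=\sum_{i=|k-l|}^{k+l}\sum_m (kp,ln\mid im)_t\,e^i_m ,$$ where $e^i_m$ denotes the vector corresponding to the weight basis vector of the summand $V^i$; the numbers $(kp,ln\mid im)_t$ are the quantum Clebsch–Gordan coefficients (they depend on the isomorphism through one non-zero factor for each $i$), and $(kp,ln\mid im)_t=0$ if $V^i$ does not occur in the sum. The isomorphism can be chosen so that all the coefficients are real. Let $T\in \mathrm{Hom}(V^k,\mathrm{Hom}(V^l,V^j))$ be an (irreducible) tensor operator, that is, a linear map with $$T(\pi^k(a)v)=\sum_i\pi^j(a_i^{(1)})\circ T(v)\circ\pi^l(S(a_i^{(2)}))\qquad\text{for all }a\in U_t(su(2)),\ v\in V^k,\qquad \Delta(a)=\sum_i a_i^{(1)}\otimes a_i^{(2)}.$$ Then, for every choice of the isomorphism above, there is a number $\alpha\in\mathbb C$ (the reduced matrix element), which does not depend on $p,m,n$, such that the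 matrix elements of the components of $T$ in the weight bases, $T(e^k_p)e^l_n=\sum_m[T(e^k_p)]_{mn}e^j_m$, are $$[T(e^k_p)]_{mn}=\alpha\,(kp,ln\mid jm)_t\qquad\text{for all }p,m,n.$$ If moreover the coefficients $(kp,ln\mid jm)_t$ and all the matrix elements $[T(e^k_p)]_{mn}$ are real, then $\alpha$ can be taken real. -/

import Mathlib

open scoped TensorProduct

noncomputable section

/-! ### Tensor operators for Hopf algebras -/

section Hopf

variable {A : Type*} [Ring A] [HopfAlgebra ℂ A]
variable {V W U : Type*} [AddCommGroup V] [Module ℂ V] [AddCommGroup W] [Module ℂ W]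
  [AddCommGroup U] [Module ℂ U]

/-- The action `δ` of a Hopf algebra `A` on `Hom(W, U)`:
`δ(a) g = ∑ σ(a⁽¹⁾) ∘ g ∘ ρ(S(a⁽²⁾))`. -/
def homRep (ρ : A →ₐ[ℂ] Module.End ℂ W) (σ : A →ₐ[ℂ] Module.End ℂ U) :
    A →ₗ[ℂ] Module.End ℂ (W →ₗ[ℂ] U) :=
  TensorProduct.lift
    (LinearMap.mk₂ ℂ
      (fun a b : A =>
        (LinearMap.lcomp ℂ U (ρ (HopfAlgebra.antipode ℂ b))) ∘ₗ
          (LinearMap.compRight ℂ (σ a) : (W →ₗ[ℂ] U) →ₗ[ℂ] (W →ₗ[ℂ] U)))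
      (fun a a' b => by ext g w; simp)
      (fun c a b => by ext g w; simp)
      (fun a b b' => by ext g w; simp)
      (fun c a b => by ext g w; simp))
    ∘ₗ Coalgebra.comul

/-- The tensor product representation `a ↦ (π ⊗ ρ)(Δ a)` on `V ⊗ W`. -/
def tensorRep (π : A →ₐ[ℂ] Module.End ℂ V) (ρ : A →ₐ[ℂ] Module.End ℂ W) :
    A →ₐ[ℂ] Module.End ℂ (V ⊗[ℂ] W) :=
  ((Module.endTensorEndAlgHom (R := ℂ) (S := ℂ) (A := ℂ) (M := V) (N := W)).comp
    (Algebra.TensorProduct.map π ρ)).comp (Bialgebra.comulAlgHom ℂ A)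

/-- `T ∈ Hom(V, Hom(W, U))` is a tensor operator when it is a homomorphism of representations
from `(V, π)` to `(Hom(W, U), δ)`. -/
def IsTensorOperator (π : A →ₐ[ℂ] Module.End ℂ V) (ρ : A →ₐ[ℂ] Module.End ℂ W)
    (σ : A →ₐ[ℂ] Module.End ℂ U) (T : V →ₗ[ℂ] (W →ₗ[ℂ] U)) : Prop :=
  ∀ a : A, T ∘ₗ π a = homRep ρ σ a ∘ₗ T

end Hopf

/-! ### The Hopf algebra `U_t(su(2))`, for a nonzero real parameter `t` -/

namespace Usu2

/-- The generators `e, f, k, k⁻¹`. -/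
inductive Gen
  | e | f | k | kinv

open Gen in
/-- The defining relations. -/
inductive Rel (t : ℝˣ) : FreeAlgebra ℂ Gen → FreeAlgebra ℂ Gen → Prop
  | k_kinv : Rel t (FreeAlgebra.ι ℂ k * FreeAlgebra.ι ℂ kinv) 1
  | kinv_k : Rel t (FreeAlgebra.ι ℂ kinv * FreeAlgebra.ι ℂ k) 1
  | k_e : Rel t (FreeAlgebra.ι ℂ k * FreeAlgebra.ι ℂ e)
      (((t : ℝ) : ℂ) ^ 2 • (FreeAlgebra.ι ℂ e * FreeAlgebra.ι ℂ k))
  | k_f : Rel t (FreeAlgebra.ι ℂ k * FreeAlgebra.ι ℂ f)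
      (((t : ℝ) : ℂ) ^ (-2 : ℤ) • (FreeAlgebra.ι ℂ f * FreeAlgebra.ι ℂ k))
  | e_f : Rel t
      (FreeAlgebra.ι ℂ e * FreeAlgebra.ι ℂ f - FreeAlgebra.ι ℂ f * FreeAlgebra.ι ℂ e)
      ((((t : ℝ) : ℂ) ^ 2 - ((t : ℝ) : ℂ) ^ (-2 : ℤ))⁻¹ •
        (FreeAlgebra.ι ℂ k ^ 2 - FreeAlgebra.ι ℂ kinv ^ 2))

end Usu2

/-- The algebra with generators `e, f, k, k⁻¹` and relations `k k⁻¹ = k⁻¹ k = 1`,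
`k e = t² e k`, `k f = t⁻² f k`, `[e, f] = (k² - k⁻²) / (t² - t⁻²)`. -/
def Usu2 (t : ℝˣ) : Type := RingQuot (Usu2.Rel t)

namespace Usu2

variable (t : ℝˣ)

instance : Ring (Usu2 t) := inferInstanceAs (Ring (RingQuot (Usu2.Rel t)))

instance : Algebra ℂ (Usu2 t) := inferInstanceAs (Algebra ℂ (RingQuot (Usu2.Rel t)))

/-- The class of a generator. -/
def gen (x : Gen) : Usu2 t := RingQuot.mkAlgHom ℂ (Rel t) (FreeAlgebra.ι ℂ x)

abbrev e : Usu2 t := gen t Gen.e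
abbrev f : Usu2 t := gen t Gen.f
abbrev k : Usu2 t := gen t Gen.k
abbrev kinv : Usu2 t := gen t Gen.kinv

theorem k_mul_kinv : k t * kinv t = 1 := by
  simpa using! RingQuot.mkAlgHom_rel ℂ (Rel.k_kinv (t := t))

theorem kinv_mul_k : kinv t * k t = 1 := by
  simpa using! RingQuot.mkAlgHom_rel ℂ (Rel.kinv_k (t := t))

theorem k_mul_e : k t * e t = ((t : ℝ) : ℂ) ^ 2 • (e t * k t) := by
  simpa using! RingQuot.mkAlgHom_rel ℂ (Rel.k_e (t := t))

theorem k_mul_f : k t * f t = ((t : ℝ) : ℂ) ^ (-2 : ℤ) • (f t * k t) := by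
  simpa using! RingQuot.mkAlgHom_rel ℂ (Rel.k_f (t := t))

theorem e_mul_f_sub : e t * f t - f t * e t =
    (((t : ℝ) : ℂ) ^ 2 - ((t : ℝ) : ℂ) ^ (-2 : ℤ))⁻¹ • (k t ^ 2 - kinv t ^ 2) := by
  simpa using! RingQuot.mkAlgHom_rel ℂ (Rel.e_f (t := t))

theorem ne0 : ((t : ℝ) : ℂ) ≠ 0 := by exact_mod_cast t.ne_zero

variable {t}

/-- The algebra homomorphism determined by the images of the generators. -/
def lift {B : Type*} [Ring B] [Algebra ℂ B] (E F K K' : B)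
    (h1 : K * K' = 1) (h2 : K' * K = 1)
    (h3 : K * E = ((t : ℝ) : ℂ) ^ 2 • (E * K))
    (h4 : K * F = ((t : ℝ) : ℂ) ^ (-2 : ℤ) • (F * K))
    (h5 : E * F - F * E =
      (((t : ℝ) : ℂ) ^ 2 - ((t : ℝ) : ℂ) ^ (-2 : ℤ))⁻¹ • (K ^ 2 - K' ^ 2)) :
    Usu2 t →ₐ[ℂ] B :=
  RingQuot.liftAlgHom ℂ ⟨FreeAlgebra.lift ℂ (fun x => match x with
    | Gen.e => E | Gen.f => F | Gen.k => K | Gen.kinv => K'), by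
      intro x y h
      induction h with
      | k_kinv => simpa using h1
      | kinv_k => simpa using h2
      | k_e => simpa using h3
      | k_f => simpa using h4
      | e_f => simpa using h5⟩

section lift
variable {B : Type*} [Ring B] [Algebra ℂ B] {E F K K' : B}
    (h1 : K * K' = 1) (h2 : K' * K = 1)
    (h3 : K * E = ((t : ℝ) : ℂ) ^ 2 • (E * K))
    (h4 : K * F = ((t : ℝ) : ℂ) ^ (-2 : ℤ) • (F * K))
    (h5 : E * F - F * E =
      (((t : ℝ) : ℂ) ^ 2 - ((t : ℝ) : ℂ) ^ (-2 : ℤ))⁻¹ • (K ^ 2 - K' ^ 2))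

@[simp] theorem lift_e : lift E F K K' h1 h2 h3 h4 h5 (e t) = E := by
  refine (RingQuot.liftAlgHom_mkAlgHom_apply ℂ _ _ _).trans ?_
  simp
@[simp] theorem lift_f : lift E F K K' h1 h2 h3 h4 h5 (f t) = F := by
  refine (RingQuot.liftAlgHom_mkAlgHom_apply ℂ _ _ _).trans ?_
  simp
@[simp] theorem lift_k : lift E F K K' h1 h2 h3 h4 h5 (k t) = K := by
  refine (RingQuot.liftAlgHom_mkAlgHom_apply ℂ _ _ _).trans ?_
  simp
@[simp] theorem lift_kinv : lift E F K K' h1 h2 h3 h4 h5 (kinv t) = K' := by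
  refine (RingQuot.liftAlgHom_mkAlgHom_apply ℂ _ _ _).trans ?_
  simp
end lift

theorem hom_ext {B : Type*} [Ring B] [Algebra ℂ B] {φ ψ : Usu2 t →ₐ[ℂ] B}
    (he : φ (e t) = ψ (e t)) (hf : φ (f t) = ψ (f t)) (hk : φ (k t) = ψ (k t))
    (hk' : φ (kinv t) = ψ (kinv t)) : φ = ψ := by
  refine RingQuot.ringQuot_ext' ℂ φ ψ (FreeAlgebra.hom_ext (funext fun x => ?_))
  cases x
  · exact he
  · exact hf
  · exact hk
  · exact hk'

theorem induction {P : Usu2 t → Prop} (hc : ∀ c : ℂ, P (algebraMap ℂ _ c))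
    (hg : ∀ x, P (gen t x)) (hm : ∀ x y, P x → P y → P (x * y))
    (ha : ∀ x y, P x → P y → P (x + y)) (x : Usu2 t) : P x := by
  obtain ⟨y, rfl⟩ := RingQuot.mkAlgHom_surjective ℂ (Rel t) x
  induction y using FreeAlgebra.induction with
  | grade0 r => simpa using! hc r
  | grade1 x => exact hg x
  | mul a b h1 h2 => simpa using! hm _ _ h1 h2
  | add a b h1 h2 => simpa using! ha _ _ h1 h2

variable (t)

theorem e_mul_k : e t * k t = ((t : ℝ) : ℂ) ^ (-2 : ℤ) • (k t * e t) := by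
  have := ne0 t
  rw [k_mul_e, smul_smul]
  field_simp
  simp

theorem f_mul_k : f t * k t = ((t : ℝ) : ℂ) ^ 2 • (k t * f t) := by
  have := ne0 t
  rw [k_mul_f, smul_smul]
  field_simp
  simp

theorem kinv_mul_e : kinv t * e t = ((t : ℝ) : ℂ) ^ (-2 : ℤ) • (e t * kinv t) := by
  calc kinv t * e t = kinv t * (e t * k t) * kinv t := by
        simp only [mul_assoc, k_mul_kinv, mul_one]
    _ = _ := by
        rw [e_mul_k, mul_smul_comm, ← mul_assoc, kinv_mul_k, one_mul, smul_mul_assoc]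

theorem kinv_mul_f : kinv t * f t = ((t : ℝ) : ℂ) ^ 2 • (f t * kinv t) := by
  calc kinv t * f t = kinv t * (f t * k t) * kinv t := by
        simp only [mul_assoc, k_mul_kinv, mul_one]
    _ = _ := by
        rw [f_mul_k, mul_smul_comm, ← mul_assoc, kinv_mul_k, one_mul, smul_mul_assoc]

/-- The coproduct: `Δ(k^{±1}) = k^{±1} ⊗ k^{±1}`, `Δ(e) = e ⊗ k⁻¹ + k ⊗ e`,
`Δ(f) = f ⊗ k⁻¹ + k ⊗ f`. -/
def comulHom : Usu2 t →ₐ[ℂ] Usu2 t ⊗[ℂ] Usu2 t :=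
  lift (e t ⊗ₜ kinv t + k t ⊗ₜ e t) (f t ⊗ₜ kinv t + k t ⊗ₜ f t) (k t ⊗ₜ k t)
    (kinv t ⊗ₜ kinv t)
    (by simp [k_mul_kinv, Algebra.TensorProduct.one_def])
    (by simp [kinv_mul_k, Algebra.TensorProduct.one_def])
    (by
      simp only [mul_add, add_mul, Algebra.TensorProduct.tmul_mul_tmul, k_mul_e, k_mul_kinv,
        kinv_mul_k, smul_add, TensorProduct.smul_tmul', TensorProduct.tmul_smul])
    (by
      simp only [mul_add, add_mul, Algebra.TensorProduct.tmul_mul_tmul, k_mul_f, k_mul_kinv,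
        kinv_mul_k, smul_add, TensorProduct.smul_tmul', TensorProduct.tmul_smul])
    (by
      have h0 := ne0 t
      have h := e_mul_f_sub t
      have hc : (((t : ℝ) : ℂ) ^ (-2 : ℤ)) * ((t : ℝ) : ℂ) ^ 2 = 1 := by field_simp
      have e1 : (e t * k t) ⊗ₜ[ℂ] (kinv t * f t) = (k t * e t) ⊗ₜ[ℂ] (f t * kinv t) := by
        rw [e_mul_k, kinv_mul_f, TensorProduct.smul_tmul, smul_smul, hc, one_smul]
      have e2 : (k t * f t) ⊗ₜ[ℂ] (e t * kinv t) = (f t * k t) ⊗ₜ[ℂ] (kinv t * e t) := by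
        rw [k_mul_f, kinv_mul_e, TensorProduct.smul_tmul]
      have e3 : e t * f t = f t * e t +
          (((t : ℝ) : ℂ) ^ 2 - ((t : ℝ) : ℂ) ^ (-2 : ℤ))⁻¹ • (k t ^ 2 - kinv t ^ 2) := by
        rw [← h]; abel
      simp only [mul_add, add_mul, Algebra.TensorProduct.tmul_mul_tmul, e1, e2, e3,
        pow_two, TensorProduct.tmul_add, TensorProduct.add_tmul, TensorProduct.tmul_smul,
        ← TensorProduct.smul_tmul', TensorProduct.tmul_sub, TensorProduct.sub_tmul, smul_sub]
      abel)

/-- The counit: `ε(k^{±1}) = 1`, `ε(e) = ε(f) = 0`. -/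
def counitHom : Usu2 t →ₐ[ℂ] ℂ :=
  lift 0 0 1 1 (by simp) (by simp) (by simp) (by simp) (by simp)

/-- The antipode, as an algebra homomorphism to the opposite algebra: `S(k^{±1}) = k^{∓1}`,
`S(e) = -t⁻² e`, `S(f) = -t² f`. -/
def antipodeHom : Usu2 t →ₐ[ℂ] (Usu2 t)ᵐᵒᵖ :=
  lift (MulOpposite.op (-(((t : ℝ) : ℂ) ^ (-2 : ℤ) • e t)))
    (MulOpposite.op (-(((t : ℝ) : ℂ) ^ 2 • f t)))
    (MulOpposite.op (kinv t)) (MulOpposite.op (k t))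
    (by simp [← MulOpposite.op_mul, k_mul_kinv])
    (by simp [← MulOpposite.op_mul, kinv_mul_k])
    (by
      rw [← MulOpposite.op_mul, ← MulOpposite.op_mul, ← MulOpposite.op_smul]
      congr 1
      have h0 := ne0 t
      rw [mul_neg, neg_mul, smul_neg, mul_smul_comm, smul_mul_assoc, kinv_mul_e, smul_smul,
        smul_smul]
      congr 2
      field_simp)
    (by
      rw [← MulOpposite.op_mul, ← MulOpposite.op_mul, ← MulOpposite.op_smul]
      congr 1
      have h0 := ne0 t
      rw [mul_neg, neg_mul, smul_neg, mul_smul_comm, smul_mul_assoc, kinv_mul_f, smul_smul,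
        smul_smul]
      congr 2
      field_simp)
    (by
      have h0 := ne0 t
      have hc : (((t : ℝ) : ℂ) ^ (-2 : ℤ)) * ((t : ℝ) : ℂ) ^ 2 = 1 := by field_simp
      have hc' : ((t : ℝ) : ℂ) ^ 2 * (((t : ℝ) : ℂ) ^ (-2 : ℤ)) = 1 := by rw [mul_comm, hc]
      rw [← MulOpposite.op_mul, ← MulOpposite.op_mul, ← MulOpposite.op_pow,
        ← MulOpposite.op_pow, ← MulOpposite.op_sub, ← MulOpposite.op_sub, ← MulOpposite.op_smul]
      congr 1
      rw [neg_mul_neg, neg_mul_neg, smul_mul_smul_comm, smul_mul_smul_comm, hc, hc', one_smul,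
        one_smul, ← neg_sub, e_mul_f_sub, ← smul_neg, neg_sub])

@[simp] theorem comulHom_e : comulHom t (e t) = e t ⊗ₜ kinv t + k t ⊗ₜ e t := lift_e ..
@[simp] theorem comulHom_f : comulHom t (f t) = f t ⊗ₜ kinv t + k t ⊗ₜ f t := lift_f ..
@[simp] theorem comulHom_k : comulHom t (k t) = k t ⊗ₜ k t := lift_k ..
@[simp] theorem comulHom_kinv : comulHom t (kinv t) = kinv t ⊗ₜ kinv t := lift_kinv ..
@[simp] theorem counitHom_e : counitHom t (e t) = 0 := lift_e ..
@[simp] theorem counitHom_f : counitHom t (f t) = 0 := lift_f ..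
@[simp] theorem counitHom_k : counitHom t (k t) = 1 := lift_k ..
@[simp] theorem counitHom_kinv : counitHom t (kinv t) = 1 := lift_kinv ..
@[simp] theorem antipodeHom_e : antipodeHom t (e t) =
    MulOpposite.op (-(((t : ℝ) : ℂ) ^ (-2 : ℤ) • e t)) := lift_e ..
@[simp] theorem antipodeHom_f : antipodeHom t (f t) =
    MulOpposite.op (-(((t : ℝ) : ℂ) ^ 2 • f t)) := lift_f ..
@[simp] theorem antipodeHom_k : antipodeHom t (k t) = MulOpposite.op (kinv t) := lift_k ..
@[simp] theorem antipodeHom_kinv : antipodeHom t (kinv t) = MulOpposite.op (k t) := lift_kinv ..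

instance : Bialgebra ℂ (Usu2 t) :=
  Bialgebra.ofAlgHom (comulHom t) (counitHom t)
    (by
      apply hom_ext <;>
        simp [TensorProduct.tmul_add, TensorProduct.add_tmul, add_assoc])
    (by apply hom_ext <;> simp)
    (by apply hom_ext <;> simp)

/-- The antipode as a linear map. -/
def antipodeLin : Usu2 t →ₗ[ℂ] Usu2 t :=
  (MulOpposite.opLinearEquiv ℂ).symm.toLinearMap ∘ₗ (antipodeHom t).toLinearMap

theorem antipodeLin_mul (x y : Usu2 t) :
    antipodeLin t (x * y) = antipodeLin t y * antipodeLin t x := by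
  simp [antipodeLin]

theorem antipodeLin_algebraMap (c : ℂ) :
    antipodeLin t (algebraMap ℂ (Usu2 t) c) = algebraMap ℂ (Usu2 t) c := by
  simp [antipodeLin]

@[simp] theorem antipodeLin_one : antipodeLin t 1 = 1 := by
  simp [antipodeLin]

@[simp] theorem antipodeLin_e :
    antipodeLin t (e t) = -(((t : ℝ) : ℂ) ^ (-2 : ℤ) • e t) := by
  simp [antipodeLin]

@[simp] theorem antipodeLin_f : antipodeLin t (f t) = -(((t : ℝ) : ℂ) ^ 2 • f t) := by
  simp [antipodeLin]

@[simp] theorem antipodeLin_k : antipodeLin t (k t) = kinv t := by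
  simp [antipodeLin]

@[simp] theorem antipodeLin_kinv : antipodeLin t (kinv t) = k t := by
  simp [antipodeLin]

theorem antipode_left (x : Usu2 t) :
    LinearMap.mul' ℂ (Usu2 t) ((antipodeLin t).rTensor (Usu2 t) (comulHom t x)) =
      algebraMap ℂ _ (counitHom t x) := by
  induction x using induction with
  | hc c => simp [Algebra.TensorProduct.algebraMap_apply, antipodeLin_algebraMap]
  | hg x =>
    have h0 := ne0 t
    cases x
    · change LinearMap.mul' ℂ (Usu2 t) ((antipodeLin t).rTensor (Usu2 t) (comulHom t (e t))) =
        algebraMap ℂ _ (counitHom t (e t))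
      simp [kinv_mul_e]
    · change LinearMap.mul' ℂ (Usu2 t) ((antipodeLin t).rTensor (Usu2 t) (comulHom t (f t))) =
        algebraMap ℂ _ (counitHom t (f t))
      simp [kinv_mul_f]
    · change LinearMap.mul' ℂ (Usu2 t) ((antipodeLin t).rTensor (Usu2 t) (comulHom t (k t))) =
        algebraMap ℂ _ (counitHom t (k t))
      simp [kinv_mul_k]
    · change LinearMap.mul' ℂ (Usu2 t) ((antipodeLin t).rTensor (Usu2 t) (comulHom t (kinv t))) =
        algebraMap ℂ _ (counitHom t (kinv t))
      simp [k_mul_kinv]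
  | hm x y hx hy =>
    have key : ∀ z w : Usu2 t ⊗[ℂ] Usu2 t, ∀ c : ℂ,
        LinearMap.mul' ℂ (Usu2 t) ((antipodeLin t).rTensor (Usu2 t) z) = algebraMap ℂ _ c →
        LinearMap.mul' ℂ (Usu2 t) ((antipodeLin t).rTensor (Usu2 t) (z * w)) =
          c • LinearMap.mul' ℂ (Usu2 t) ((antipodeLin t).rTensor (Usu2 t) w) := by
      intro z w c hz
      induction w with
      | zero => simp
      | add w w' h h' => simp only [mul_add, map_add, h, h', smul_add]
      | tmul a b =>
        have : ∀ z : Usu2 t ⊗[ℂ] Usu2 t,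
            LinearMap.mul' ℂ (Usu2 t) ((antipodeLin t).rTensor (Usu2 t) (z * a ⊗ₜ b)) =
            antipodeLin t a *
              LinearMap.mul' ℂ (Usu2 t) ((antipodeLin t).rTensor (Usu2 t) z) * b := by
          intro z
          induction z with
          | zero => simp
          | add z z' h h' => simp only [add_mul, map_add, h, h', mul_add]
          | tmul p q => simp [antipodeLin_mul, mul_assoc]
        rw [this, hz]
        simp [Algebra.algebraMap_eq_smul_one]
    rw [map_mul, key _ _ _ hx, hy, map_mul, map_mul, Algebra.smul_def]
  | ha x y hx hy => simp only [map_add, hx, hy]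

theorem antipode_right (x : Usu2 t) :
    LinearMap.mul' ℂ (Usu2 t) ((antipodeLin t).lTensor (Usu2 t) (comulHom t x)) =
      algebraMap ℂ _ (counitHom t x) := by
  induction x using induction with
  | hc c => simp [Algebra.TensorProduct.algebraMap_apply]
  | hg x =>
    have h0 := ne0 t
    cases x
    · change LinearMap.mul' ℂ (Usu2 t) ((antipodeLin t).lTensor (Usu2 t) (comulHom t (e t))) =
        algebraMap ℂ _ (counitHom t (e t))
      simp [e_mul_k]
    · change LinearMap.mul' ℂ (Usu2 t) ((antipodeLin t).lTensor (Usu2 t) (comulHom t (f t))) =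
        algebraMap ℂ _ (counitHom t (f t))
      simp [f_mul_k]
    · change LinearMap.mul' ℂ (Usu2 t) ((antipodeLin t).lTensor (Usu2 t) (comulHom t (k t))) =
        algebraMap ℂ _ (counitHom t (k t))
      simp [k_mul_kinv]
    · change LinearMap.mul' ℂ (Usu2 t) ((antipodeLin t).lTensor (Usu2 t) (comulHom t (kinv t))) =
        algebraMap ℂ _ (counitHom t (kinv t))
      simp [kinv_mul_k]
  | hm x y hx hy =>
    have key : ∀ z w : Usu2 t ⊗[ℂ] Usu2 t, ∀ c : ℂ,
        LinearMap.mul' ℂ (Usu2 t) ((antipodeLin t).lTensor (Usu2 t) z) = algebraMap ℂ _ c →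
        LinearMap.mul' ℂ (Usu2 t) ((antipodeLin t).lTensor (Usu2 t) (w * z)) =
          c • LinearMap.mul' ℂ (Usu2 t) ((antipodeLin t).lTensor (Usu2 t) w) := by
      intro z w c hz
      induction w with
      | zero => simp
      | add w w' h h' => simp only [add_mul, map_add, h, h', smul_add]
      | tmul a b =>
        have : ∀ z : Usu2 t ⊗[ℂ] Usu2 t,
            LinearMap.mul' ℂ (Usu2 t) ((antipodeLin t).lTensor (Usu2 t) (a ⊗ₜ b * z)) =
            a * LinearMap.mul' ℂ (Usu2 t) ((antipodeLin t).lTensor (Usu2 t) z) *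
              antipodeLin t b := by
          intro z
          induction z with
          | zero => simp
          | add z z' h h' => simp only [add_mul, map_add, h, h', mul_add]
          | tmul p q => simp [antipodeLin_mul, mul_assoc]
        rw [this, hz]
        simp [Algebra.algebraMap_eq_smul_one]
    rw [map_mul, key _ _ _ hy, hx, map_mul, map_mul, Algebra.smul_def,
      (Algebra.commutes _ _)]
  | ha x y hx hy => simp only [map_add, hx, hy]

instance : HopfAlgebra ℂ (Usu2 t) where
  antipode := antipodeLin t
  mul_antipode_rTensor_comul := LinearMap.ext (antipode_left t)
  mul_antipode_lTensor_comul := LinearMap.ext (antipode_right t)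

/-! ### The irreducible representations `(V^l, π^l)`

The spin `l ∈ {0, 1/2, 1, …}` is given by the natural number `a = 2l`. The weight basis vector
`e_m`, `m = -l, …, l`, is the standard basis vector with index `i = l + m ∈ {0, …, a}`; hence
`l - m = a - i` and `2m = 2i - a`. -/

/-- `[n] = (t^{2n} - t^{-2n}) / (t² - t⁻²)`. -/
def qInt (n : ℤ) : ℝ :=
  ((t : ℝ) ^ (2 * n) - (t : ℝ) ^ (-(2 * n))) / ((t : ℝ) ^ 2 - (t : ℝ) ^ (-2 : ℤ))

/-- The space `V^l` of dimension `2l + 1 = a + 1`. -/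
abbrev Spin (a : ℕ) : Type := Fin (a + 1) → ℂ

/-- The matrix of `e` in `V^l`: `e · e_m = ([l - m][l + m + 1])^{1/2} e_{m+1}`. -/
def matE (a : ℕ) : Matrix (Fin (a + 1)) (Fin (a + 1)) ℂ := Matrix.of fun i j =>
  if (i : ℕ) = (j : ℕ) + 1 then
    ((Real.sqrt (qInt t ((a : ℤ) - (j : ℕ)) * qInt t ((j : ℕ) + 1)) : ℝ) : ℂ) else 0

/-- The matrix of `f` in `V^l`: `f · e_m = ([l + m][l - m + 1])^{1/2} e_{m-1}`. -/
def matF (a : ℕ) : Matrix (Fin (a + 1)) (Fin (a + 1)) ℂ := Matrix.of fun i j =>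
  if (i : ℕ) + 1 = (j : ℕ) then
    ((Real.sqrt (qInt t (j : ℕ) * qInt t ((a : ℤ) - (j : ℕ) + 1)) : ℝ) : ℂ) else 0

/-- The matrix of `k` in `V^l`: `k · e_m = t^{2m} e_m`. -/
def matK (a : ℕ) : Matrix (Fin (a + 1)) (Fin (a + 1)) ℂ :=
  Matrix.diagonal fun i => ((t : ℝ) : ℂ) ^ (2 * ((i : ℕ) : ℤ) - a)

/-- The matrix of `k⁻¹` in `V^l`: `k⁻¹ · e_m = t^{-2m} e_m`. -/
def matKinv (a : ℕ) : Matrix (Fin (a + 1)) (Fin (a + 1)) ℂ :=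
  Matrix.diagonal fun i => ((t : ℝ) : ℂ) ^ (-(2 * ((i : ℕ) : ℤ) - a))

theorem qInt_nonneg {n : ℤ} (hn : 0 ≤ n) : 0 ≤ qInt t n := by
  have h0 : (t : ℝ) ≠ 0 := t.ne_zero
  have hq : 0 < (t : ℝ) ^ 2 := by positivity
  have e1 : (t : ℝ) ^ (2 * n) = ((t : ℝ) ^ 2) ^ n := by
    rw [zpow_mul]; norm_cast
  have e2 : (t : ℝ) ^ (-(2 * n)) = (((t : ℝ) ^ 2) ^ n)⁻¹ := by rw [zpow_neg, e1]
  have e3 : (t : ℝ) ^ (-2 : ℤ) = ((t : ℝ) ^ 2)⁻¹ := by rw [zpow_neg]; norm_cast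
  rw [qInt, e1, e2, e3]
  generalize (t : ℝ) ^ 2 = q at hq
  rcases le_total 1 q with h | h
  · have h1 : 1 ≤ q ^ n := one_le_zpow₀ h hn
    apply div_nonneg
    · have := inv_le_one_of_one_le₀ h1; linarith
    · have := inv_le_one_of_one_le₀ h; linarith
  · have h1 : q ^ n ≤ 1 := zpow_le_one₀ hq h hn
    apply div_nonneg_of_nonpos
    · have := (one_le_inv₀ (zpow_pos hq n)).2 h1; linarith
    · have := (one_le_inv₀ hq).2 h; linarith

theorem qInt_identity (x y : ℤ) :
    qInt t x * qInt t (y + 1) - qInt t y * qInt t (x + 1) =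
      ((t : ℝ) ^ 2 - (t : ℝ) ^ (-2 : ℤ))⁻¹ *
        (((t : ℝ) ^ (x - y)) ^ 2 - ((t : ℝ) ^ (-(x - y))) ^ 2) := by
  have h0 : (t : ℝ) ≠ 0 := t.ne_zero
  by_cases hd : (t : ℝ) ^ 2 - (t : ℝ) ^ (-2 : ℤ) = 0
  · simp only [qInt, hd]; simp
  simp only [qInt]
  rw [show 2 * (y + 1) = y + y + 2 by ring, show 2 * (x + 1) = x + x + 2 by ring,
    show 2 * x = x + x by ring, show 2 * y = y + y by ring]
  simp only [zpow_add₀ h0, zpow_neg, zpow_sub₀ h0, mul_inv] at hd ⊢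
  have hx : (t : ℝ) ^ x ≠ 0 := zpow_ne_zero _ h0
  have hy : (t : ℝ) ^ y ≠ 0 := zpow_ne_zero _ h0
  generalize (t : ℝ) ^ x = X at *
  generalize (t : ℝ) ^ y = Y at *
  have e3 : (t : ℝ) ^ (2 : ℤ) = (t : ℝ) ^ 2 := by norm_cast
  rw [e3] at hd ⊢
  have h2 : (t : ℝ) ^ 2 ≠ 0 := pow_ne_zero 2 h0
  generalize (t : ℝ) ^ 2 = q at *
  rw [div_mul_div_comm, div_mul_div_comm, ← sub_div, div_eq_iff (mul_ne_zero hd hd),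
    mul_comm ((q - q⁻¹)⁻¹), mul_assoc _ (q - q⁻¹)⁻¹, inv_mul_cancel_left₀ hd]
  field_simp
  ring

theorem matE_mul_matF (a : ℕ) : matE t a * matF t a =
    Matrix.diagonal fun i : Fin (a + 1) => ((qInt t (i : ℕ) * qInt t ((a : ℤ) - (i : ℕ) + 1) : ℝ) : ℂ) := by
  ext i j
  rw [Matrix.mul_apply]
  rcases Nat.eq_zero_or_pos (i : ℕ) with hi | hi
  · rw [Finset.sum_eq_zero]
    · rw [Matrix.diagonal_apply]
      split_ifs
      · simp [hi, qInt]
      · rfl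
    · intro x _
      simp [matE, hi]
  · have hlt : (i : ℕ) - 1 < a + 1 := by omega
    rw [Finset.sum_eq_single (⟨(i : ℕ) - 1, hlt⟩ : Fin (a + 1))]
    · have hsub : ((i : ℕ) - 1 : ℕ) + 1 = (i : ℕ) := by omega
      have hc : (((i : ℕ) - 1 : ℕ) : ℤ) = (i : ℕ) - 1 := by omega
      rw [Matrix.diagonal_apply]
      by_cases hij : i = j
      · subst hij
        have hnn : 0 ≤ qInt t (i : ℕ) * qInt t ((a : ℤ) - (i : ℕ) + 1) :=
          mul_nonneg (qInt_nonneg t (by omega)) (qInt_nonneg t (by omega))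
        simp only [matE, matF, Matrix.of_apply, hsub, hc, if_true]
        rw [show (a : ℤ) - (((i : ℕ) : ℤ) - 1) = (a : ℤ) - (i : ℕ) + 1 by ring,
          show ((i : ℕ) : ℤ) - 1 + 1 = (i : ℕ) by ring,
          mul_comm (qInt t ((a : ℤ) - (i : ℕ) + 1)), ← Complex.ofReal_mul,
          Real.mul_self_sqrt hnn]
      · have : (i : ℕ) ≠ (j : ℕ) := fun h => hij (Fin.ext h)
        simp [matE, matF, hsub, hij, this]
    · intro x _ hx
      have : (i : ℕ) ≠ (x : ℕ) + 1 := fun h => hx (Fin.ext (by simp; omega))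
      simp [matE, this]
    · simp

theorem matF_mul_matE (a : ℕ) : matF t a * matE t a =
    Matrix.diagonal fun i : Fin (a + 1) => ((qInt t ((a : ℤ) - (i : ℕ)) * qInt t ((i : ℕ) + 1) : ℝ) : ℂ) := by
  ext i j
  rw [Matrix.mul_apply]
  rcases Nat.lt_or_ge (i : ℕ) a with hi | hi
  · have hlt : (i : ℕ) + 1 < a + 1 := by omega
    rw [Finset.sum_eq_single (⟨(i : ℕ) + 1, hlt⟩ : Fin (a + 1))]
    · rw [Matrix.diagonal_apply]
      by_cases hij : i = j
      · subst hij
        have hnn : 0 ≤ qInt t ((a : ℤ) - (i : ℕ)) * qInt t ((i : ℕ) + 1) :=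
          mul_nonneg (qInt_nonneg t (by omega)) (qInt_nonneg t (by omega))
        simp only [matE, matF, Matrix.of_apply, if_true, Nat.cast_add, Nat.cast_one]
        rw [show (a : ℤ) - (((i : ℕ) : ℤ) + 1) + 1 = (a : ℤ) - (i : ℕ) by ring,
          mul_comm (qInt t (((i : ℕ) : ℤ) + 1)), ← Complex.ofReal_mul,
          Real.mul_self_sqrt hnn]
      · have : (i : ℕ) ≠ (j : ℕ) := fun h => hij (Fin.ext h)
        simp [matE, matF, hij, this]
    · intro x _ hx
      have : (i : ℕ) + 1 ≠ (x : ℕ) := fun h => hx (Fin.ext h.symm)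
      simp [matF, this]
    · simp
  · have hia : (i : ℕ) = a := by omega
    rw [Finset.sum_eq_zero]
    · rw [Matrix.diagonal_apply]
      split_ifs
      · simp [hia, qInt]
      · rfl
    · intro x _
      have : (i : ℕ) + 1 ≠ (x : ℕ) := by omega
      simp [matF, this]

/-- The representation of `U_t(su(2))` on `V^l` by matrices. -/
def matRep (a : ℕ) : Usu2 t →ₐ[ℂ] Matrix (Fin (a + 1)) (Fin (a + 1)) ℂ :=
  lift (matE t a) (matF t a) (matK t a) (matKinv t a)
    (by
      have h0 := ne0 t
      rw [matK, matKinv, Matrix.diagonal_mul_diagonal, ← Matrix.diagonal_one]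
      congr 1; ext i
      rw [← zpow_add₀ h0]; simp)
    (by
      have h0 := ne0 t
      rw [matK, matKinv, Matrix.diagonal_mul_diagonal, ← Matrix.diagonal_one]
      congr 1; ext i
      rw [← zpow_add₀ h0]; simp)
    (by
      have h0 := ne0 t
      ext i j
      rw [matK, Matrix.diagonal_mul, Matrix.smul_apply, Matrix.mul_diagonal, smul_eq_mul]
      simp only [matE, Matrix.of_apply]
      split_ifs with h
      · rw [h, show (2 * (((j : ℕ) + 1 : ℕ) : ℤ) - a) = 2 + (2 * ((j : ℕ) : ℤ) - a) by
          push_cast; ring, zpow_add₀ h0,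
          show ((t : ℝ) : ℂ) ^ (2 : ℤ) = ((t : ℝ) : ℂ) ^ 2 from zpow_natCast _ 2]
        ring
      · simp)
    (by
      have h0 := ne0 t
      ext i j
      rw [matK, Matrix.diagonal_mul, Matrix.smul_apply, Matrix.mul_diagonal, smul_eq_mul]
      simp only [matF, Matrix.of_apply]
      split_ifs with h
      · rw [← h, show (2 * ((i : ℕ) : ℤ) - a) = -2 + (2 * (((i : ℕ) + 1 : ℕ) : ℤ) - a) by
          push_cast; ring, zpow_add₀ h0]
        ring
      · simp)
    (by
      rw [matE_mul_matF, matF_mul_matE, matK, matKinv, Matrix.diagonal_pow, Matrix.diagonal_pow,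
        Matrix.diagonal_sub, Matrix.diagonal_sub, ← Matrix.diagonal_smul]
      congr 1; ext i
      have h := qInt_identity t (i : ℕ) ((a : ℤ) - (i : ℕ))
      rw [show ((i : ℕ) : ℤ) - ((a : ℤ) - (i : ℕ)) = 2 * ((i : ℕ) : ℤ) - a by ring] at h
      have h' := congrArg (fun x : ℝ => (x : ℂ)) h
      push_cast at h'
      simp only [Pi.smul_apply, Pi.pow_apply, smul_eq_mul]
      push_cast
      exact h')

/-- The irreducible representation `(V^l, π^l)` of spin `l = a / 2`. -/
def spinRep (a : ℕ) : Usu2 t →ₐ[ℂ] Module.End ℂ (Spin a) :=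
  (Matrix.toLinAlgEquiv' (R := ℂ) (n := Fin (a + 1))).toAlgHom.comp (matRep t a)

/-! ### Clebsch–Gordan coefficients -/

/-- The values of `2j` for `j = |k - l|, |k - l| + 1, …, k + l`, where `a = 2k` and `b = 2l`. -/
def cgSpins (a b : ℕ) : Finset ℕ :=
  (Finset.Icc ((a : ℤ) - b).natAbs (a + b)).filter fun c => Even (a + b + c)

/-- A Clebsch–Gordan decomposition `V^k ⊗ V^l = ⨁_{j = |k - l|}^{k + l} V^j`, that is, an
isomorphism of representations between the two sides (`a = 2k`, `b = 2l`). -/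
structure CGDecomposition (a b : ℕ) where
  /-- The isomorphism. -/
  iso : Spin a ⊗[ℂ] Spin b ≃ₗ[ℂ] ((c : cgSpins a b) → Spin c)
  map_rep : ∀ (x : Usu2 t) (w : Spin a ⊗[ℂ] Spin b) (c : cgSpins a b),
    iso (tensorRep (spinRep t a) (spinRep t b) x w) c = spinRep t c x (iso w c)

variable {t} in
/-- The Clebsch–Gordan coefficient `(kp, ln | jm)_t` of a decomposition: the coefficient of
`e_m^j` in `e_p^k ⊗ e_n^l`, and zero when `V^j` does not occur in `V^k ⊗ V^l`. Here `c = 2j`. -/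
def CGDecomposition.coeff {a b : ℕ} (D : CGDecomposition t a b) (c : ℕ)
    (p : Fin (a + 1)) (n : Fin (b + 1)) (m : Fin (c + 1)) : ℂ :=
  if h : c ∈ cgSpins a b then
    D.iso ((Pi.single p 1 : Spin a) ⊗ₜ[ℂ] (Pi.single n 1 : Spin b)) ⟨c, h⟩ m
  else 0

end Usu2
end

namespace Usu2

variable {t : ℝˣ}

/-! Spins are doubled throughout, so `V^c` has dimension `c + 1`. A tensor operator `T` is the same
thing as an intertwiner: `v ⊗ w ↦ T(v) w` commutes with the action on `V^k ⊗ V^l`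
(`lift_intertwines`). Precomposing it with the inverse of a Clebsch–Gordan isomorphism and
restricting to the summands gives intertwiners `V^i → V^j`. By Schur's lemma these are zero for `i ≠
j` and a scalar `α` for `i = j`. Since each spin occurs at most once, evaluating at `e_p ⊗ e_n`
leaves `α` times the coefficient. Schur's lemma itself is a highest weight argument: an intertwiner
is determined by the image of the top vector, that image is killed by `e`, and the kernel of `e` on
`V^j` is the top line. All of this uses that the powers of `t` are distinct, so that the positive
quantum integers do not vanish.

For the existence of a real decomposition, `e v = 0` is solved explicitly by a `v` with real
coordinates in each required weight (`exists_highestWeight`). Applying `f` repeatedly to `v` gives a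
copy of `V^c`; the string stops after `c` steps because `e` and `f` are adjoint on the tensor
product (`tensorRep_f_eq_zero`). The sum of these copies is direct since the top vectors have
different weights (`sum_apply_injective`), and a dimension count (`sum_cgSpins`) makes it
everything. Every step is defined over the reals, hence so are the coefficients. -/

/-! ### Powers of `t` and positivity of quantum integers -/

theorem sq_zpow_injective (ht : (t : ℝ) ^ 2 ≠ 1) :
    Function.Injective fun n : ℤ => ((t : ℝ) ^ 2) ^ n :=
  zpow_right_injective₀ (by have := t.ne_zero; positivity) ht

/-- Since `t` may be negative, the equality is squared to reach the positive base `t²`. -/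
theorem zpow_injective (ht : (t : ℝ) ^ 2 ≠ 1) :
    Function.Injective fun n : ℤ => ((t : ℝ) : ℂ) ^ n := by
  intro m n h
  have h' : (t : ℝ) ^ m = (t : ℝ) ^ n := by
    have : (((t : ℝ) ^ m : ℝ) : ℂ) = (((t : ℝ) ^ n : ℝ) : ℂ) := by push_cast; exact h
    exact_mod_cast this
  apply sq_zpow_injective ht
  change ((t : ℝ) ^ 2) ^ m = ((t : ℝ) ^ 2) ^ n
  rw [← zpow_natCast, zpow_comm, h', zpow_comm]

/-- Numerator and denominator have the shape `(t²)^m - (t²)^(-m)`, with `m = n` and `m = 1`, and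
distinct powers of `t²` differ. -/
theorem qInt_pos (ht : (t : ℝ) ^ 2 ≠ 1) {n : ℤ} (hn : 0 < n) : 0 < qInt t n := by
  refine lt_of_le_of_ne (qInt_nonneg t hn.le) (Ne.symm ?_)
  have key : ∀ m : ℤ, 0 < m → (t : ℝ) ^ (2 * m) - (t : ℝ) ^ (-(2 * m)) ≠ 0 := by
    intro m hm h
    have h2 : ∀ r : ℤ, (t : ℝ) ^ (2 * r) = ((t : ℝ) ^ 2) ^ r := by
      intro r; rw [zpow_mul]; norm_cast
    have h3 : ((t : ℝ) ^ 2) ^ m = ((t : ℝ) ^ 2) ^ (-m) := by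
      rw [← h2, ← h2, mul_neg]; linarith
    have := sq_zpow_injective ht h3
    omega
  have h1 := key 1 one_pos
  rw [mul_one] at h1
  exact div_ne_zero (key n hn) (by exact_mod_cast h1)

variable (t) in
/-- The matrix element `([c - i][i + 1])^{1/2}` of `e` between the weight vectors `i` and
`i + 1`. -/
noncomputable def ladder (c : ℕ) (i : ℤ) : ℝ := Real.sqrt (qInt t (c - i) * qInt t (i + 1))

theorem ladder_ne_zero (ht : (t : ℝ) ^ 2 ≠ 1) {c : ℕ} {i : ℤ} (h0 : 0 ≤ i) (h1 : i < c) :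
    ((ladder t c i : ℝ) : ℂ) ≠ 0 := by
  rw [Complex.ofReal_ne_zero, ladder, Real.sqrt_ne_zero']
  exact mul_pos (qInt_pos ht (by omega)) (qInt_pos ht (by omega))

theorem ladder_mul_self {c : ℕ} {i : ℤ} (h0 : 0 ≤ i) (h1 : i ≤ c) :
    ladder t c i * ladder t c i = qInt t (c - i) * qInt t (i + 1) :=
  Real.mul_self_sqrt (mul_nonneg (qInt_nonneg t (by omega)) (qInt_nonneg t (by omega)))

/-- Reconciles two countings: strings generated by `f` are numbered from the top, the weight basis
from the bottom. -/
theorem ladder_symm (c : ℕ) (i : ℤ) : ladder t c (c - 1 - i) = ladder t c i := by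
  rw [ladder, ladder, mul_comm]
  congr 3 <;> ring

/-! ### The action on the weight bases -/

theorem spinRep_e (a : ℕ) (x : Spin a) : spinRep t a (e t) x = Matrix.mulVec (matE t a) x := by
  simp [spinRep, matRep]

theorem spinRep_f (a : ℕ) (x : Spin a) : spinRep t a (f t) x = Matrix.mulVec (matF t a) x := by
  simp [spinRep, matRep]

theorem spinRep_k (a : ℕ) (x : Spin a) : spinRep t a (k t) x = Matrix.mulVec (matK t a) x := by
  simp [spinRep, matRep]

theorem spinRep_kinv (a : ℕ) (x : Spin a) :
    spinRep t a (kinv t) x = Matrix.mulVec (matKinv t a) x := by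
  simp [spinRep, matRep]

theorem matE_mulVec_succ (a : ℕ) (x : Spin a) (i : Fin a) :
    Matrix.mulVec (matE t a) x i.succ = (ladder t a (i : ℕ) : ℂ) * x i.castSucc := by
  rw [Matrix.mulVec, dotProduct, Finset.sum_eq_single i.castSucc]
  · simp [matE, ladder]
  · intro b _ hb
    have : (i : ℕ) ≠ b := fun h => hb (Fin.ext (by simp [h]))
    simp [matE, this]
  · simp

theorem spinRep_e_single_castSucc (a : ℕ) (i : Fin a) :
    spinRep t a (e t) (Pi.single i.castSucc 1) =
      (ladder t a (i : ℕ) : ℂ) • (Pi.single i.succ 1 : Spin a) := by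
  rw [spinRep_e, Matrix.mulVec_single_one]
  ext j
  by_cases h : j = i.succ
  · subst h; simp [matE, ladder]
  · have : (j : ℕ) ≠ i + 1 := fun h' => h (Fin.ext (by simp [h']))
    simp [matE, this, h]

theorem spinRep_e_single_last (a : ℕ) :
    spinRep t a (e t) (Pi.single (Fin.last a) 1) = 0 := by
  rw [spinRep_e, Matrix.mulVec_single_one]
  ext j
  have : (j : ℕ) ≠ a + 1 := by omega
  simp [matE, this]

theorem spinRep_f_single_succ (a : ℕ) (i : Fin a) :
    spinRep t a (f t) (Pi.single i.succ 1) =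
      (ladder t a (i : ℕ) : ℂ) • (Pi.single i.castSucc 1 : Spin a) := by
  rw [spinRep_f, Matrix.mulVec_single_one]
  ext j
  by_cases h : j = i.castSucc
  · subst h
    have h2 : (a : ℤ) - ((i : ℕ) + 1) + 1 = a - (i : ℕ) := by ring
    simp [matF, ladder, mul_comm (qInt t ((i : ℕ) + 1)), h2]
  · have : (j : ℕ) ≠ i := fun h' => h (Fin.ext (by simp [h']))
    simp [matF, this, h]

theorem spinRep_f_single_zero (a : ℕ) : spinRep t a (f t) (Pi.single 0 1) = 0 := by
  rw [spinRep_f, Matrix.mulVec_single_one]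
  ext j
  simp [matF]

theorem spinRep_k_single (a : ℕ) (i : Fin (a + 1)) :
    spinRep t a (k t) (Pi.single i 1) =
      ((t : ℝ) : ℂ) ^ (2 * ((i : ℕ) : ℤ) - a) • (Pi.single i 1 : Spin a) := by
  rw [spinRep_k, matK, Matrix.diagonal_mulVec_single, ← Pi.single_smul]
  simp

theorem spinRep_kinv_single (a : ℕ) (i : Fin (a + 1)) :
    spinRep t a (kinv t) (Pi.single i 1) =
      ((t : ℝ) : ℂ) ^ (-(2 * ((i : ℕ) : ℤ) - a)) • (Pi.single i 1 : Spin a) := by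
  rw [spinRep_kinv, matKinv, Matrix.diagonal_mulVec_single, ← Pi.single_smul]
  simp

/-- Coordinate `i + 1` of `e x` is a nonzero multiple of coordinate `i` of `x`, so only the top
coordinate is free. -/
theorem eq_smul_single_last_of_spinRep_e_eq_zero (ht : (t : ℝ) ^ 2 ≠ 1) {a : ℕ} {x : Spin a}
    (hx : spinRep t a (e t) x = 0) : x = x (Fin.last a) • (Pi.single (Fin.last a) 1 : Spin a) := by
  ext i
  induction i using Fin.lastCases with
  | last => simp
  | cast i =>
    have h := congrFun hx i.succ
    rw [spinRep_e, matE_mulVec_succ] at h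
    have h0 := ladder_ne_zero ht (c := a) (i := (i : ℕ)) (by omega) (by omega)
    have : x i.castSucc = 0 := (mul_eq_zero.1 h).resolve_left h0
    simp [this]

/-! ### Intertwiners -/

section Intertwiner

variable {N : Type*} [AddCommGroup N] [Module ℂ N] {σ : Usu2 t →ₐ[ℂ] Module.End ℂ N}

/-- A linear map commuting with the generators is a homomorphism of representations. -/
theorem intertwines_of_gen {M : Type*} [AddCommGroup M] [Module ℂ M]
    {ρ : Usu2 t →ₐ[ℂ] Module.End ℂ M} {φ : M →ₗ[ℂ] N}
    (h : ∀ (x : Gen) (z : M), φ (ρ (gen t x) z) = σ (gen t x) (φ z)) (x : Usu2 t) (z : M) :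
    φ (ρ x z) = σ x (φ z) := by
  induction x using induction generalizing z with
  | hc c => simp [Module.algebraMap_end_apply]
  | hg x => exact h x z
  | hm x y hx hy => simp [hx, hy]
  | ha x y hx hy => simp [hx, hy]

/-- Each lower weight vector is a nonzero multiple of `f` applied to the one above it, so the top
vector generates `V^c` under `f`. -/
theorem linearMap_ext_of_spinRep_f (ht : (t : ℝ) ^ 2 ≠ 1) {c : ℕ} {φ ψ : Spin c →ₗ[ℂ] N}
    (hφ : ∀ z, φ (spinRep t c (f t) z) = σ (f t) (φ z))
    (hψ : ∀ z, ψ (spinRep t c (f t) z) = σ (f t) (ψ z))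
    (h : φ (Pi.single (Fin.last c) 1) = ψ (Pi.single (Fin.last c) 1)) : φ = ψ := by
  refine (Pi.basisFun ℂ (Fin (c + 1))).ext fun i => ?_
  rw [Pi.basisFun_apply]
  induction i using Fin.reverseInduction with
  | last => exact h
  | cast i ih =>
    have h0 := ladder_ne_zero ht (c := c) (i := (i : ℕ)) (by omega) (by omega)
    have h1 := hφ (Pi.single i.succ 1)
    rw [ih, ← hψ, spinRep_f_single_succ, map_smul, map_smul] at h1
    exact smul_right_injective N h0 h1

/-- Schur's lemma: the intertwiners between the irreducible representations. -/
theorem exists_eq_smul_of_intertwines (ht : (t : ℝ) ^ 2 ≠ 1) {j : ℕ} {ψ : Spin j →ₗ[ℂ] Spin j}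
    (he : ∀ z, ψ (spinRep t j (e t) z) = spinRep t j (e t) (ψ z))
    (hf : ∀ z, ψ (spinRep t j (f t) z) = spinRep t j (f t) (ψ z)) :
    ∃ α : ℂ, ∀ z, ψ z = α • z := by
  have h := he (Pi.single (Fin.last j) 1)
  rw [spinRep_e_single_last, map_zero] at h
  refine ⟨ψ (Pi.single (Fin.last j) 1) (Fin.last j), fun z => ?_⟩
  refine LinearMap.congr_fun
    (g := ψ (Pi.single (Fin.last j) 1) (Fin.last j) • (LinearMap.id : Spin j →ₗ[ℂ] Spin j))
    (linearMap_ext_of_spinRep_f (σ := spinRep t j) ht hf (fun z => by simp) ?_) z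
  exact eq_smul_single_last_of_spinRep_e_eq_zero ht h.symm

/-- The top vector of `V^c` must go to the top line of `V^j`, but `k` acts by `t^c` on the former
and by `t^j` on the latter. -/
theorem eq_zero_of_intertwines (ht : (t : ℝ) ^ 2 ≠ 1) {c j : ℕ} (hcj : c ≠ j)
    {ψ : Spin c →ₗ[ℂ] Spin j}
    (he : ∀ z, ψ (spinRep t c (e t) z) = spinRep t j (e t) (ψ z))
    (hf : ∀ z, ψ (spinRep t c (f t) z) = spinRep t j (f t) (ψ z))
    (hk : ∀ z, ψ (spinRep t c (k t) z) = spinRep t j (k t) (ψ z)) : ψ = 0 := by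
  have h := he (Pi.single (Fin.last c) 1)
  rw [spinRep_e_single_last, map_zero] at h
  have h1 := eq_smul_single_last_of_spinRep_e_eq_zero ht h.symm
  refine linearMap_ext_of_spinRep_f ht hf (by simp) ?_
  have h2 := hk (Pi.single (Fin.last c) 1)
  rw [spinRep_k_single, map_smul, h1, map_smul, spinRep_k_single] at h2
  have h3 := congrFun h2 (Fin.last j)
  rw [h1, LinearMap.zero_apply]
  by_cases h4 : ψ (Pi.single (Fin.last c) 1) (Fin.last j) = 0
  · rw [h4, zero_smul]
  · exfalso
    simp only [Pi.smul_apply, Pi.single_eq_same, smul_eq_mul, mul_one, Fin.val_last] at h3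
    rw [mul_comm] at h3
    have h5 := zpow_injective ht (mul_left_cancel₀ h4 h3)
    omega

/-! ### Strings generated by a highest weight vector -/

variable (σ) in
/-- The normalized vectors obtained from a highest weight vector `v` of weight `c` by
applying `f` repeatedly. -/
noncomputable def descend (c : ℕ) (v : N) : ℕ → N
  | 0 => v
  | n + 1 => (ladder t c n : ℂ)⁻¹ • σ (f t) (descend c v n)

variable {c : ℕ} {v : N}

theorem apply_k_descend (hk : σ (k t) v = ((t : ℝ) : ℂ) ^ (c : ℤ) • v) (n : ℕ) :
    σ (k t) (descend σ c v n) = ((t : ℝ) : ℂ) ^ ((c : ℤ) - 2 * n) • descend σ c v n := by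
  induction n with
  | zero => simpa [descend] using hk
  | succ n ih =>
    have h := congrArg (fun x => σ x (descend σ c v n)) (k_mul_f t)
    simp only [map_mul, map_smul, Module.End.mul_apply, LinearMap.smul_apply, ih] at h
    rw [descend, map_smul, h, smul_smul (_ ^ (-2 : ℤ)), ← zpow_add₀ (ne0 t), smul_comm]
    congr 2
    push_cast; ring

theorem apply_kinv_of_apply_k {z : N} {m : ℤ} (h : σ (k t) z = ((t : ℝ) : ℂ) ^ m • z) :
    σ (kinv t) z = ((t : ℝ) : ℂ) ^ (-m) • z := by
  have h1 := congrArg (fun x => σ x z) (kinv_mul_k t)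
  simp only [map_mul, map_one, Module.End.mul_apply, Module.End.one_apply, h, map_smul] at h1
  rw [zpow_neg, eq_inv_smul_iff₀ (zpow_ne_zero m (ne0 t)), h1]

/-- On weight `x - y` the commutator `[e, f]` acts by `[x][y+1] - [y][x+1]`, by `qInt_identity`.
This drives the induction down the string, with `x = c - n` and `y = n`. -/
theorem apply_e_f_of_apply_k {z : N} {x y : ℤ}
    (h : σ (k t) z = ((t : ℝ) : ℂ) ^ (x - y) • z)
    (h' : σ (f t) (σ (e t) z) = ((qInt t y * qInt t (x + 1) : ℝ) : ℂ) • z) :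
    σ (e t) (σ (f t) z) = ((qInt t x * qInt t (y + 1) : ℝ) : ℂ) • z := by
  have h1 := congrArg (fun x => σ x z) (e_mul_f_sub t)
  simp only [map_mul, map_sub, map_smul, pow_two, Module.End.mul_apply,
    LinearMap.smul_apply, LinearMap.sub_apply, h, apply_kinv_of_apply_k h, h', smul_smul,
    ← sub_smul] at h1
  rw [sub_eq_iff_eq_add.1 h1, ← add_smul]
  have h2 := qInt_identity t x y
  rw [sub_eq_iff_eq_add] at h2
  rw [h2]
  congr 1
  push_cast
  ring

/-- Inductively, `e` sends the next vector of the string to a multiple of `e f` applied to the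
current one, hence to a multiple of the current one; `f` then leads back. -/
theorem apply_f_e_descend (he : σ (e t) v = 0)
    (hk : σ (k t) v = ((t : ℝ) : ℂ) ^ (c : ℤ) • v) {n : ℕ} (hn : n ≤ c) :
    σ (f t) (σ (e t) (descend σ c v n)) =
      ((qInt t n * qInt t ((c : ℤ) - n + 1) : ℝ) : ℂ) • descend σ c v n := by
  induction n with
  | zero => simp [descend, he, qInt]
  | succ n ih =>
    have h := ih (by omega)
    have h1 := apply_e_f_of_apply_k (x := (c : ℤ) - n) (y := n) (by
      rw [apply_k_descend hk]; congr 2; ring) h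
    rw [descend, map_smul, h1, map_smul, map_smul, smul_comm, mul_comm (qInt t ((n + 1 : ℕ) : ℤ)),
      show (c : ℤ) - ((n + 1 : ℕ) : ℤ) + 1 = c - n by push_cast; ring, Nat.cast_succ]

theorem apply_e_descend_succ (ht : (t : ℝ) ^ 2 ≠ 1) (he : σ (e t) v = 0)
    (hk : σ (k t) v = ((t : ℝ) : ℂ) ^ (c : ℤ) • v) {n : ℕ} (hn : n < c) :
    σ (e t) (descend σ c v (n + 1)) = (ladder t c n : ℂ) • descend σ c v n := by
  have h1 := apply_e_f_of_apply_k (x := (c : ℤ) - n) (y := n) (by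
      rw [apply_k_descend hk]; congr 2; ring) (apply_f_e_descend he hk hn.le)
  have h0 := ladder_ne_zero ht (c := c) (i := n) (by omega) (by omega)
  rw [descend, map_smul, h1, ← ladder_mul_self (by omega) (by omega), smul_smul,
    Complex.ofReal_mul, inv_mul_cancel_left₀ h0]

theorem apply_f_descend (ht : (t : ℝ) ^ 2 ≠ 1) {n : ℕ} (hn : n < c) :
    σ (f t) (descend σ c v n) = (ladder t c n : ℂ) • descend σ c v (n + 1) := by
  have h0 := ladder_ne_zero ht (c := c) (i := n) (by omega) (by omega)
  rw [descend, smul_smul, mul_inv_cancel₀ h0, one_smul]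

/-- At the end of the string `e f` acts by `[0][c+1] = 0`. The hypothesis `hσ` takes the place of
finite dimensionality in concluding that `f` already vanishes there. -/
theorem apply_f_descend_self (he : σ (e t) v = 0)
    (hk : σ (k t) v = ((t : ℝ) : ℂ) ^ (c : ℤ) • v)
    (hσ : ∀ z, σ (e t) (σ (f t) z) = 0 → σ (f t) z = 0) :
    σ (f t) (descend σ c v c) = 0 := by
  apply hσ
  have h1 := apply_e_f_of_apply_k (x := (c : ℤ) - c) (y := c) (by
      rw [apply_k_descend hk]; congr 2; ring) (apply_f_e_descend he hk le_rfl)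
  rw [h1]
  simp [qInt]

variable (σ) in
/-- The linear map `V^c → N` sending the weight basis to the vectors obtained from `v`. -/
noncomputable def highestWeightMap (c : ℕ) (v : N) : Spin c →ₗ[ℂ] N :=
  Fintype.linearCombination ℂ fun i : Fin (c + 1) => descend σ c v (c - i)

theorem highestWeightMap_single (i : Fin (c + 1)) :
    highestWeightMap σ c v (Pi.single i 1) = descend σ c v (c - i) := by
  simp [highestWeightMap]

theorem highestWeightMap_intertwines (ht : (t : ℝ) ^ 2 ≠ 1) (he : σ (e t) v = 0)
    (hk : σ (k t) v = ((t : ℝ) : ℂ) ^ (c : ℤ) • v)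
    (hσ : ∀ z, σ (e t) (σ (f t) z) = 0 → σ (f t) z = 0) (x : Gen) (z : Spin c) :
    highestWeightMap σ c v (spinRep t c (gen t x) z) =
      σ (gen t x) (highestWeightMap σ c v z) := by
  suffices h : highestWeightMap σ c v ∘ₗ spinRep t c (gen t x) =
      σ (gen t x) ∘ₗ highestWeightMap σ c v from LinearMap.congr_fun h z
  refine (Pi.basisFun ℂ (Fin (c + 1))).ext fun i => ?_
  rw [Pi.basisFun_apply, LinearMap.comp_apply, LinearMap.comp_apply, highestWeightMap_single]
  have hki := apply_k_descend hk (c - i)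
  have hw : (c : ℤ) - 2 * ((c - i : ℕ) : ℤ) = 2 * ((i : ℕ) : ℤ) - c := by omega
  rw [hw] at hki
  cases x with
  | e =>
    induction i using Fin.lastCases with
    | last => simp [spinRep_e_single_last, descend, he]
    | cast i =>
      have h1 := apply_e_descend_succ ht he hk (n := c - 1 - i) (by omega)
      rw [show c - 1 - (i : ℕ) + 1 = c - (i.castSucc : Fin (c + 1)) by simp; omega] at h1
      rw [h1, spinRep_e_single_castSucc, map_smul, highestWeightMap_single,
        show ((c - 1 - i : ℕ) : ℤ) = c - 1 - (i : ℕ) by omega, ladder_symm]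
      congr 2
      simp; omega
  | f =>
    induction i using Fin.cases with
    | zero => simp [spinRep_f_single_zero, apply_f_descend_self he hk hσ]
    | succ i =>
      have h1 := apply_f_descend (σ := σ) (v := v) ht (c := c) (n := c - i.succ)
        (by rw [Fin.val_succ]; omega)
      rw [h1, spinRep_f_single_succ, map_smul, highestWeightMap_single,
        show ((c - (i.succ : Fin (c + 1)) : ℕ) : ℤ) = c - 1 - (i : ℕ) by simp; omega, ladder_symm]
      congr 2
      simp; omega
  | k =>
    rw [hki, spinRep_k_single, map_smul, highestWeightMap_single]
  | kinv =>
    rw [apply_kinv_of_apply_k hki, spinRep_kinv_single, map_smul, highestWeightMap_single]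

end Intertwiner

/-! ### Tensor operators as intertwiners -/

section TensorOperator

variable {V W U : Type*} [AddCommGroup V] [Module ℂ V] [AddCommGroup W] [Module ℂ W]
  [AddCommGroup U] [Module ℂ U] (π : Usu2 t →ₐ[ℂ] Module.End ℂ V)
  (ρ : Usu2 t →ₐ[ℂ] Module.End ℂ W) (σ : Usu2 t →ₐ[ℂ] Module.End ℂ U)

theorem tensorRep_e : tensorRep π ρ (e t) =
    TensorProduct.map (π (e t)) (ρ (kinv t)) + TensorProduct.map (π (k t)) (ρ (e t)) := by
  change Module.endTensorEndAlgHom (Algebra.TensorProduct.map π ρ (comulHom t (e t))) = _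
  simp only [comulHom_e, map_add, Algebra.TensorProduct.map_tmul,
    Module.endTensorEndAlgHom_apply]
  rfl

theorem tensorRep_f : tensorRep π ρ (f t) =
    TensorProduct.map (π (f t)) (ρ (kinv t)) + TensorProduct.map (π (k t)) (ρ (f t)) := by
  change Module.endTensorEndAlgHom (Algebra.TensorProduct.map π ρ (comulHom t (f t))) = _
  simp only [comulHom_f, map_add, Algebra.TensorProduct.map_tmul,
    Module.endTensorEndAlgHom_apply]
  rfl

theorem tensorRep_k : tensorRep π ρ (k t) = TensorProduct.map (π (k t)) (ρ (k t)) := by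
  change Module.endTensorEndAlgHom (Algebra.TensorProduct.map π ρ (comulHom t (k t))) = _
  simp only [comulHom_k, Algebra.TensorProduct.map_tmul,
    Module.endTensorEndAlgHom_apply]
  rfl

theorem tensorRep_kinv : tensorRep π ρ (kinv t) =
    TensorProduct.map (π (kinv t)) (ρ (kinv t)) := by
  change Module.endTensorEndAlgHom (Algebra.TensorProduct.map π ρ (comulHom t (kinv t))) = _
  simp only [comulHom_kinv, Algebra.TensorProduct.map_tmul,
    Module.endTensorEndAlgHom_apply]
  rfl

theorem homRep_e (g : W →ₗ[ℂ] U) (w : W) : homRep ρ σ (e t) g w =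
    σ (e t) (g (ρ (k t) w)) -
      ((t : ℝ) : ℂ) ^ (-2 : ℤ) • σ (k t) (g (ρ (e t) w)) := by
  have h0 : Coalgebra.comul (R := ℂ) (e t) = _ := comulHom_e t
  have h1 : HopfAlgebra.antipode ℂ (kinv t) = k t := antipodeLin_kinv t
  have h2 : HopfAlgebra.antipode ℂ (e t) = _ := antipodeLin_e t
  simp [homRep, h0, h1, h2, sub_eq_add_neg]

theorem homRep_f (g : W →ₗ[ℂ] U) (w : W) : homRep ρ σ (f t) g w =
    σ (f t) (g (ρ (k t) w)) -
      ((t : ℝ) : ℂ) ^ 2 • σ (k t) (g (ρ (f t) w)) := by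
  have h0 : Coalgebra.comul (R := ℂ) (f t) = _ := comulHom_f t
  have h1 : HopfAlgebra.antipode ℂ (kinv t) = k t := antipodeLin_kinv t
  have h2 : HopfAlgebra.antipode ℂ (f t) = _ := antipodeLin_f t
  simp [homRep, h0, h1, h2, sub_eq_add_neg]

theorem homRep_k (g : W →ₗ[ℂ] U) (w : W) :
    homRep ρ σ (k t) g w = σ (k t) (g (ρ (kinv t) w)) := by
  have h0 : Coalgebra.comul (R := ℂ) (k t) = _ := comulHom_k t
  have h1 : HopfAlgebra.antipode ℂ (k t) = kinv t := antipodeLin_k t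
  simp [homRep, h0, h1]

theorem homRep_kinv (g : W →ₗ[ℂ] U) (w : W) :
    homRep ρ σ (kinv t) g w = σ (kinv t) (g (ρ (k t) w)) := by
  have h0 : Coalgebra.comul (R := ℂ) (kinv t) = _ := comulHom_kinv t
  have h1 : HopfAlgebra.antipode ℂ (kinv t) = k t := antipodeLin_kinv t
  simp [homRep, h0, h1]

variable {π ρ σ}

theorem apply_k_apply_kinv (w : W) : ρ (k t) (ρ (kinv t) w) = w := by
  rw [← Module.End.mul_apply, ← map_mul, k_mul_kinv, map_one, Module.End.one_apply]

theorem apply_kinv_apply_k (w : W) : ρ (kinv t) (ρ (k t) w) = w := by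
  rw [← Module.End.mul_apply, ← map_mul, kinv_mul_k, map_one, Module.End.one_apply]

/-- A tensor operator `V → Hom(W, U)` induces a homomorphism of representations
`V ⊗ W → U`. -/
theorem lift_intertwines {T : V →ₗ[ℂ] (W →ₗ[ℂ] U)} (hT : IsTensorOperator π ρ σ T) (x : Gen)
    (z : V ⊗[ℂ] W) :
    TensorProduct.lift T (tensorRep π ρ (gen t x) z) =
      σ (gen t x) (TensorProduct.lift T z) := by
  have hT' : ∀ a v w, T (π a v) w = homRep ρ σ a (T v) w := fun a v w =>
    LinearMap.congr_fun (LinearMap.congr_fun (hT a) v) w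
  induction z with
  | zero => simp
  | add z z' h h' => simp only [map_add, h, h']
  | tmul v w =>
    cases x with
    | e =>
      -- Moving `k⁻¹` past `e` costs `t⁻²`, exactly the factor in the antipode of `e`; the two terms
      -- containing `σ(k)` then cancel.
      have h := congrArg (fun x => ρ x w) (kinv_mul_e t)
      simp only [map_mul, map_smul, Module.End.mul_apply, LinearMap.smul_apply] at h
      rw [tensorRep_e]
      simp only [LinearMap.add_apply, TensorProduct.map_tmul, map_add, TensorProduct.lift.tmul,
        hT', homRep_e, homRep_k, apply_k_apply_kinv, h, map_smul]
      abel
    | f =>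
      have h := congrArg (fun x => ρ x w) (kinv_mul_f t)
      simp only [map_mul, map_smul, Module.End.mul_apply, LinearMap.smul_apply] at h
      rw [tensorRep_f]
      simp only [LinearMap.add_apply, TensorProduct.map_tmul, map_add, TensorProduct.lift.tmul,
        hT', homRep_f, homRep_k, apply_k_apply_kinv, h, map_smul]
      abel
    | k =>
      rw [tensorRep_k]
      simp only [TensorProduct.map_tmul, TensorProduct.lift.tmul, hT', homRep_k,
        apply_kinv_apply_k]
    | kinv =>
      rw [tensorRep_kinv]
      simp only [TensorProduct.map_tmul, TensorProduct.lift.tmul, hT', homRep_kinv,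
        apply_k_apply_kinv]

end TensorOperator

/-- The homomorphisms of representations from `V^k ⊗ V^l` to `V^j` are given by the
Clebsch–Gordan coefficients, up to a factor. -/
theorem CGDecomposition.exists_apply_eq_mul_coeff (ht : (t : ℝ) ^ 2 ≠ 1) {a b : ℕ}
    (D : CGDecomposition t a b) {j : ℕ} {ψ : Spin a ⊗[ℂ] Spin b →ₗ[ℂ] Spin j}
    (hψ : ∀ (x : Gen) z, ψ (tensorRep (spinRep t a) (spinRep t b) (gen t x) z) =
      spinRep t j (gen t x) (ψ z)) :
    ∃ α : ℂ, ∀ p n m, ψ ((Pi.single p 1 : Spin a) ⊗ₜ[ℂ] (Pi.single n 1 : Spin b)) m =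
      α * D.coeff j p n m := by
  classical
  -- `ι c` is the restriction of `ψ` to the summand `V^c`.
  let ι (c : cgSpins a b) : Spin c →ₗ[ℂ] Spin j :=
    ψ ∘ₗ D.iso.symm.toLinearMap ∘ₗ LinearMap.single ℂ (fun c : cgSpins a b => Spin c) c
  have hι (c : cgSpins a b) (x : Gen) (z : Spin c) :
      ι c (spinRep t c (gen t x) z) = spinRep t j (gen t x) (ι c z) := by
    simp only [ι, LinearMap.comp_apply, LinearEquiv.coe_coe, ← hψ]
    congr 1
    rw [LinearEquiv.symm_apply_eq]
    ext1 d
    rw [D.map_rep, LinearEquiv.apply_symm_apply, LinearMap.single_apply, LinearMap.single_apply]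
    by_cases h : d = c
    · subst h; simp
    · simp [h]
  have hsum (z : Spin a ⊗[ℂ] Spin b) : ψ z = ∑ c, ι c (D.iso z c) := by
    conv_lhs => rw [← D.iso.symm_apply_apply z, ← Finset.univ_sum_single (D.iso z)]
    simp [ι]
  have hne (c : cgSpins a b) (h : (c : ℕ) ≠ j) : ι c = 0 :=
    eq_zero_of_intertwines ht h (hι c Gen.e) (hι c Gen.f) (hι c Gen.k)
  by_cases hj : j ∈ cgSpins a b
  · obtain ⟨α, hα⟩ := exists_eq_smul_of_intertwines ht (hι ⟨j, hj⟩ Gen.e) (hι ⟨j, hj⟩ Gen.f)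
    refine ⟨α, fun p n m => ?_⟩
    rw [hsum, Finset.sum_eq_single ⟨j, hj⟩, hα, CGDecomposition.coeff, dif_pos hj]
    · rfl
    · intro c _ hc
      rw [hne c fun h => hc (Subtype.ext h), LinearMap.zero_apply]
    · simp
  · refine ⟨0, fun p n m => ?_⟩
    rw [hsum, Finset.sum_eq_zero, zero_mul, Pi.zero_apply]
    intro c _
    rw [hne c fun h => hj (h ▸ c.2), LinearMap.zero_apply]

/-- The Wigner–Eckart theorem. -/
theorem CGDecomposition.exists_reduced_matrix_element (ht : (t : ℝ) ^ 2 ≠ 1) {a b j : ℕ}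
    (D : CGDecomposition t a b) {T : Spin a →ₗ[ℂ] (Spin b →ₗ[ℂ] Spin j)}
    (hT : IsTensorOperator (spinRep t a) (spinRep t b) (spinRep t j) T) :
    ∃ α : ℂ, ∀ p n m,
      LinearMap.toMatrix' (T (Pi.single p 1)) m n = α * D.coeff j p n m := by
  obtain ⟨α, hα⟩ := D.exists_apply_eq_mul_coeff ht (lift_intertwines hT)
  refine ⟨α, fun p n m => ?_⟩
  rw [← hα, TensorProduct.lift.tmul, LinearMap.toMatrix'_apply]

/-! ### Coordinates on the tensor product -/

open scoped Kronecker

/-- The coordinates of a tensor with respect to the vectors `e_p ⊗ e_q`. -/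
noncomputable def tensorCoords (a b : ℕ) :
    Spin a ⊗[ℂ] Spin b ≃ₗ[ℂ] (Fin (a + 1) × Fin (b + 1) → ℂ) :=
  ((Pi.basisFun ℂ (Fin (a + 1))).tensorProduct (Pi.basisFun ℂ (Fin (b + 1)))).equivFun

theorem tensorCoords_tmul {a b : ℕ} (x : Spin a) (y : Spin b) (i : Fin (a + 1) × Fin (b + 1)) :
    tensorCoords a b (x ⊗ₜ y) i = x i.1 * y i.2 := by
  obtain ⟨p, q⟩ := i
  simp [tensorCoords, mul_comm]

theorem tensorCoords_map {a b : ℕ} (x y : Usu2 t) (z : Spin a ⊗[ℂ] Spin b) :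
    tensorCoords a b (TensorProduct.map (spinRep t a x) (spinRep t b y) z) =
      Matrix.mulVec (matRep t a x ⊗ₖ matRep t b y) (tensorCoords a b z) := by
  induction z with
  | zero => simp
  | add z z' h h' => simp only [map_add, h, h', Matrix.mulVec_add]
  | tmul v w =>
    ext i
    rw [TensorProduct.map_tmul, tensorCoords_tmul]
    simp only [spinRep, AlgHom.comp_apply]
    simp only [Matrix.mulVec, dotProduct, Fintype.sum_prod_type, tensorCoords_tmul,
      Matrix.kroneckerMap_apply]
    change (Matrix.mulVec (matRep t a x) v) i.1 * (Matrix.mulVec (matRep t b y) w) i.2 = _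
    rw [Matrix.mulVec, Matrix.mulVec, dotProduct, dotProduct, Finset.sum_mul_sum]
    refine Finset.sum_congr rfl fun p _ => Finset.sum_congr rfl fun q _ => ?_
    ring

theorem matRep_e (a : ℕ) : matRep t a (e t) = matE t a := lift_e ..
theorem matRep_f (a : ℕ) : matRep t a (f t) = matF t a := lift_f ..
theorem matRep_k (a : ℕ) : matRep t a (k t) = matK t a := lift_k ..
theorem matRep_kinv (a : ℕ) : matRep t a (kinv t) = matKinv t a := lift_kinv ..

theorem tensorCoords_e {a b : ℕ} (z : Spin a ⊗[ℂ] Spin b) :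
    tensorCoords a b (tensorRep (spinRep t a) (spinRep t b) (e t) z) =
      Matrix.mulVec (matE t a ⊗ₖ matKinv t b + matK t a ⊗ₖ matE t b) (tensorCoords a b z) := by
  rw [tensorRep_e, LinearMap.add_apply, map_add, tensorCoords_map, tensorCoords_map,
    Matrix.add_mulVec, matRep_e, matRep_e, matRep_k, matRep_kinv]

theorem tensorCoords_f {a b : ℕ} (z : Spin a ⊗[ℂ] Spin b) :
    tensorCoords a b (tensorRep (spinRep t a) (spinRep t b) (f t) z) =
      Matrix.mulVec (matF t a ⊗ₖ matKinv t b + matK t a ⊗ₖ matF t b) (tensorCoords a b z) := by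
  rw [tensorRep_f, LinearMap.add_apply, map_add, tensorCoords_map, tensorCoords_map,
    Matrix.add_mulVec, matRep_f, matRep_f, matRep_k, matRep_kinv]

theorem tensorCoords_k {a b : ℕ} (z : Spin a ⊗[ℂ] Spin b) (i : Fin (a + 1) × Fin (b + 1)) :
    tensorCoords a b (tensorRep (spinRep t a) (spinRep t b) (k t) z) i =
      ((t : ℝ) : ℂ) ^ (2 * ((i.1 + i.2 : ℕ) : ℤ) - (a + b)) * tensorCoords a b z i := by
  rw [tensorRep_k, tensorCoords_map, matRep_k, matRep_k, matK, matK,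
    Matrix.diagonal_kronecker_diagonal, Matrix.mulVec_diagonal, ← zpow_add₀ (ne0 t)]
  congr 2
  push_cast; ring

/-- The square roots in the weight basis make the action unitary: `e` and `f` are real and mutually
transposed. -/
theorem conjTranspose_matF (a : ℕ) : (matF t a).conjTranspose = matE t a := by
  ext i j
  rw [Matrix.conjTranspose_apply]
  simp only [matE, matF, Matrix.of_apply]
  by_cases h : (i : ℕ) = j + 1
  · rw [if_pos h, if_pos h.symm, h, mul_comm (qInt t ((a : ℤ) - (j : ℕ))),
      show ((j + 1 : ℕ) : ℤ) = (j : ℕ) + 1 by push_cast; rfl,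
      show (a : ℤ) - ((j : ℕ) + 1) + 1 = a - (j : ℕ) by ring]
    simp
  · rw [if_neg h, if_neg (fun h' => h h'.symm), star_zero]

theorem conjTranspose_matK (a : ℕ) : (matK t a).conjTranspose = matK t a := by
  rw [matK, Matrix.diagonal_conjTranspose]
  congr 1; ext i
  simp

theorem conjTranspose_matKinv (a : ℕ) : (matKinv t a).conjTranspose = matKinv t a := by
  rw [matKinv, Matrix.diagonal_conjTranspose]
  congr 1; ext i
  simp

open scoped ComplexOrder in
/-- On `V^k ⊗ V^l` the operators `e` and `f` are adjoint to each other, so `e` is injective on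
the range of `f`. -/
theorem tensorRep_f_eq_zero {a b : ℕ} (z : Spin a ⊗[ℂ] Spin b)
    (h : tensorRep (spinRep t a) (spinRep t b) (e t)
      (tensorRep (spinRep t a) (spinRep t b) (f t) z) = 0) :
    tensorRep (spinRep t a) (spinRep t b) (f t) z = 0 := by
  apply (tensorCoords a b).injective
  have h1 := congrArg (tensorCoords a b) h
  -- Adjointness survives the coproduct because `Δ(e)` and `Δ(f)` have the same shape and `k^{±1}`
  -- are self-adjoint, `t` being real. It remains to use that `F* F z = 0` implies `F z = 0`.
  have h2 : matE t a ⊗ₖ matKinv t b + matK t a ⊗ₖ matE t b =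
      (matF t a ⊗ₖ matKinv t b + matK t a ⊗ₖ matF t b).conjTranspose := by
    simp [Matrix.conjTranspose_add, Matrix.conjTranspose_kronecker, conjTranspose_matF,
      conjTranspose_matK, conjTranspose_matKinv]
  rw [tensorCoords_e, tensorCoords_f, map_zero, h2, Matrix.mulVec_mulVec,
    Matrix.conjTranspose_mul_self_mulVec_eq_zero] at h1
  rw [tensorCoords_f, h1, map_zero]

theorem tensorCoords_e_apply {a b : ℕ} (z : Spin a ⊗[ℂ] Spin b) (P : Fin (a + 1))
    (Q : Fin (b + 1)) :
    tensorCoords a b (tensorRep (spinRep t a) (spinRep t b) (e t) z) (P, Q) =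
      ((t : ℝ) : ℂ) ^ (-(2 * ((Q : ℕ) : ℤ) - b)) *
        Matrix.mulVec (matE t a) (fun p => tensorCoords a b z (p, Q)) P +
      ((t : ℝ) : ℂ) ^ (2 * ((P : ℕ) : ℤ) - a) *
        Matrix.mulVec (matE t b) (fun q => tensorCoords a b z (P, q)) Q := by
  rw [tensorCoords_e, Matrix.add_mulVec, Pi.add_apply]
  congr 1
  · simp only [Matrix.mulVec, dotProduct, Fintype.sum_prod_type, Matrix.kroneckerMap_apply,
      matKinv, Matrix.diagonal_apply, Finset.mul_sum]
    refine Finset.sum_congr rfl fun p _ => ?_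
    rw [Finset.sum_eq_single Q]
    · rw [if_pos rfl]; ring
    · intro q _ hq; simp [hq.symm]
    · simp
  · simp only [Matrix.mulVec, dotProduct, Fintype.sum_prod_type_right, Matrix.kroneckerMap_apply,
      matK, Matrix.diagonal_apply, Finset.mul_sum]
    refine Finset.sum_congr rfl fun p _ => ?_
    rw [Finset.sum_eq_single P]
    · rw [if_pos rfl]; ring
    · intro q _ hq; simp [hq.symm]
    · simp

theorem matE_mulVec_zero (a : ℕ) (x : Spin a) : Matrix.mulVec (matE t a) x 0 = 0 := by
  simp [Matrix.mulVec, dotProduct, matE]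

/-! ### Highest weight vectors in the tensor product -/

variable (t) in
/-- The coordinates of the highest weight vector of weight `2s - (a + b)`. -/
noncomputable def highestWeightCoeff (a b s p : ℕ) : ℝ :=
  ∏ i ∈ Finset.Ico (s - b) p,
    -((t : ℝ) ^ (-(2 * ((s : ℤ) - i) - b)) * ladder t a i) /
      ((t : ℝ) ^ (2 * ((i : ℤ) + 1) - a) * ladder t b (s - i - 1))

/-- For `v = ∑ x_p e_p ⊗ e_{s-p}`, the equation `e v = 0` is a two-term recursion expressing
`x_{p+1}` through `x_p`; `highestWeightCoeff` is its product solution, with value `1` at the first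
index `p = s - b`. -/
theorem exists_highestWeight (ht : (t : ℝ) ^ 2 ≠ 1) {a b c : ℕ} (hc : c ∈ cgSpins a b) :
    ∃ v : Spin a ⊗[ℂ] Spin b, v ≠ 0 ∧
      tensorRep (spinRep t a) (spinRep t b) (e t) v = 0 ∧
      tensorRep (spinRep t a) (spinRep t b) (k t) v = ((t : ℝ) : ℂ) ^ (c : ℤ) • v ∧
      ∀ i, (tensorCoords a b v i).im = 0 := by
  rw [cgSpins, Finset.mem_filter, Finset.mem_Icc] at hc
  -- Here `s = (a + b + c) / 2`, so an index sum `s` means weight `2s - (a + b) = c`.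
  obtain ⟨⟨hc1, hc2⟩, s, hs⟩ := hc
  have hsa : a ≤ s := by omega
  have hsb : b ≤ s := by omega
  have hsab : s ≤ a + b := by omega
  let x : Fin (a + 1) × Fin (b + 1) → ℂ := fun i =>
    if (i.1 + i.2 : ℕ) = s then (highestWeightCoeff t a b s i.1 : ℂ) else 0
  have hx : tensorCoords a b ((tensorCoords a b).symm x) = x :=
    LinearEquiv.apply_symm_apply _ _
  refine ⟨(tensorCoords a b).symm x, ?_, ?_, ?_, ?_⟩
  · intro h
    have h1 := congrArg (tensorCoords a b) h
    rw [hx, map_zero] at h1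
    have h2 := congrFun h1 (⟨s - b, by omega⟩, Fin.last b)
    simp [x, highestWeightCoeff, hsb] at h2
  · apply (tensorCoords a b).injective
    rw [map_zero]
    ext ⟨P, Q⟩
    change _ = (0 : ℂ)
    rw [tensorCoords_e_apply, hx]
    induction P using Fin.cases with
    | zero =>
      induction Q using Fin.cases with
      | zero => simp [matE_mulVec_zero]
      | succ q =>
        -- The only contributing neighbour `(0, q)` has index sum `q < b ≤ s`, off the support of
        -- `x`.
        have : (q : ℕ) ≠ s := by omega
        simp [matE_mulVec_zero, matE_mulVec_succ, x, this]
    | succ p =>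
      induction Q using Fin.cases with
      | zero =>
        have : (p : ℕ) ≠ s := by omega
        simp [matE_mulVec_zero, matE_mulVec_succ, x, this]
      | succ q =>
        rw [matE_mulVec_succ, matE_mulVec_succ]
        simp only [x, Fin.val_succ, Fin.val_castSucc]
        -- The two neighbours `(p, q + 1)` and `(p + 1, q)` have equal index sums, so both lie on
        -- the support, where the recursion cancels them, or neither does.
        by_cases h : (p : ℕ) + (q + 1) = s
        · have h' : (p : ℕ) + 1 + q = s := by omega
          have hl := ladder_ne_zero ht (c := b) (i := (q : ℕ)) (by omega) (by omega)
          have h0 := ne0 t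
          have e1 : (s : ℤ) - (p : ℕ) - 1 = (q : ℕ) := by omega
          have e2 : (s : ℤ) - (p : ℕ) = ((q + 1 : ℕ) : ℤ) := by omega
          have e3 : ((p : ℕ) : ℤ) + 1 = ((p + 1 : ℕ) : ℤ) := by omega
          rw [if_pos h, if_pos h', highestWeightCoeff, highestWeightCoeff,
            Finset.prod_Ico_succ_top (by omega), e1, e2, e3]
          have hA := zpow_ne_zero (2 * ((p + 1 : ℕ) : ℤ) - a) h0
          simp only [Complex.ofReal_mul, Complex.ofReal_div, Complex.ofReal_neg,
            Complex.ofReal_zpow]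
          generalize ((∏ i ∈ Finset.Ico (s - b) (p : ℕ), _ : ℝ) : ℂ) = y
          field_simp
          ring
        · have h' : ¬ (p : ℕ) + 1 + q = s := by omega
          rw [if_neg h, if_neg h']
          simp
  · apply (tensorCoords a b).injective
    ext i
    rw [tensorCoords_k, map_smul, hx, Pi.smul_apply, smul_eq_mul]
    simp only [x]
    split_ifs with h
    · rw [h]
      congr 2
      omega
    · simp
  · intro i
    rw [hx]
    simp only [x]
    split_ifs <;> simp

/-! ### Real tensors -/

theorem im_sum_mul_eq_zero {ι : Type*} {s : Finset ι} {x y : ι → ℂ} (hx : ∀ i, (x i).im = 0)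
    (hy : ∀ i, (y i).im = 0) : (∑ i ∈ s, x i * y i).im = 0 := by
  rw [Complex.im_sum]
  exact Finset.sum_eq_zero fun i _ => by simp [hx, hy]

theorem im_ofReal_zpow (r : ℝ) (n : ℤ) : ((r : ℂ) ^ n).im = 0 := by
  rw [← Complex.ofReal_zpow, Complex.ofReal_im]

theorem im_matF (a : ℕ) (i j : Fin (a + 1)) : (matF t a i j).im = 0 := by
  simp only [matF, Matrix.of_apply]
  split_ifs <;> simp

theorem im_matK (a : ℕ) (i j : Fin (a + 1)) : (matK t a i j).im = 0 := by
  rw [matK, Matrix.diagonal_apply]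
  split_ifs
  · exact im_ofReal_zpow _ _
  · rfl

theorem im_matKinv (a : ℕ) (i j : Fin (a + 1)) : (matKinv t a i j).im = 0 := by
  rw [matKinv, Matrix.diagonal_apply]
  split_ifs
  · exact im_ofReal_zpow _ _
  · rfl

theorem im_tensorCoords_f {a b : ℕ} {z : Spin a ⊗[ℂ] Spin b}
    (hz : ∀ i, (tensorCoords a b z i).im = 0) (i : Fin (a + 1) × Fin (b + 1)) :
    (tensorCoords a b (tensorRep (spinRep t a) (spinRep t b) (f t) z) i).im = 0 := by
  rw [tensorCoords_f]
  refine im_sum_mul_eq_zero (fun j => ?_) hz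
  simp [im_matF, im_matK, im_matKinv]

theorem im_tensorCoords_descend {a b c : ℕ} {v : Spin a ⊗[ℂ] Spin b}
    (hv : ∀ i, (tensorCoords a b v i).im = 0) (n : ℕ) (i : Fin (a + 1) × Fin (b + 1)) :
    (tensorCoords a b (descend (tensorRep (spinRep t a) (spinRep t b)) c v n) i).im = 0 := by
  induction n generalizing i with
  | zero => exact hv i
  | succ n ih =>
    rw [descend, map_smul, Pi.smul_apply, smul_eq_mul, ← Complex.ofReal_inv,
      Complex.im_ofReal_mul, im_tensorCoords_f ih, mul_zero]

/-- The whole string below a real vector is real, so the embedding of `V^c` commutes with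
conjugation of coordinates. -/
theorem tensorCoords_highestWeightMap_star {a b c : ℕ} {v : Spin a ⊗[ℂ] Spin b}
    (hv : ∀ i, (tensorCoords a b v i).im = 0) (x : Spin c) :
    tensorCoords a b (highestWeightMap (tensorRep (spinRep t a) (spinRep t b)) c v (star x)) =
      star (tensorCoords a b
        (highestWeightMap (tensorRep (spinRep t a) (spinRep t b)) c v x)) := by
  ext i
  simp only [highestWeightMap, Fintype.linearCombination_apply, map_sum, map_smul,
    Finset.sum_apply, Pi.smul_apply, Pi.star_apply, star_sum, smul_eq_mul, star_mul']
  refine Finset.sum_congr rfl fun m _ => ?_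
  congr 1
  exact (Complex.conj_eq_iff_im.2 (im_tensorCoords_descend hv _ i)).symm

/-! ### The Clebsch–Gordan decomposition -/

/-- The spins form the progression `|a - b| + 2i` with `0 ≤ i ≤ min a b`. This is the equality of
dimensions that upgrades injectivity to an isomorphism. -/
theorem sum_cgSpins (a b : ℕ) : ∑ c ∈ cgSpins a b, (c + 1) = (a + 1) * (b + 1) := by
  have h : cgSpins a b =
      (Finset.range (min a b + 1)).image fun i => ((a : ℤ) - b).natAbs + 2 * i := by
    ext c
    simp only [cgSpins, Finset.mem_filter, Finset.mem_Icc, Finset.mem_image, Finset.mem_range]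
    constructor
    · rintro ⟨⟨h1, h2⟩, s, hs⟩
      exact ⟨(c - ((a : ℤ) - b).natAbs) / 2, by omega, by omega⟩
    · rintro ⟨i, hi, rfl⟩
      exact ⟨⟨by omega, by omega⟩, max a b + i, by omega⟩
  have h2 : ∀ d n : ℕ, ∑ i ∈ Finset.range (n + 1), (d + 2 * i + 1) = (n + 1) * (d + n + 1) := by
    intro d n
    induction n with
    | zero => simp
    | succ n ih => rw [Finset.sum_range_succ, ih]; ring
  rw [h, Finset.sum_image fun i _ j _ hij => by simpa using hij, h2]
  rcases le_total a b with hab | hab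
  · rw [min_eq_left hab, show ((a : ℤ) - b).natAbs + a = b by omega]
  · rw [min_eq_right hab, show ((a : ℤ) - b).natAbs + b = a by omega, mul_comm]

theorem finrank_pi_cgSpins (a b : ℕ) : Module.finrank ℂ ((c : cgSpins a b) → Spin c) =
    Module.finrank ℂ (Spin a ⊗[ℂ] Spin b) := by
  rw [Module.finrank_tensorProduct, Module.finrank_pi_fintype]
  simp only [Module.finrank_fin_fun]
  rw [Finset.sum_coe_sort (cgSpins a b) fun c => c + 1, sum_cgSpins]

/-- A homomorphism of representations on a sum of irreducible ones of different spins, which is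
non-zero on each highest weight vector, is injective. -/
theorem sum_apply_injective (ht : (t : ℝ) ^ 2 ≠ 1) {N : Type*} [AddCommGroup N] [Module ℂ N]
    {σ : Usu2 t →ₐ[ℂ] Module.End ℂ N} {S : Finset ℕ} (φ : (c : S) → Spin c →ₗ[ℂ] N)
    (hφ : ∀ c x z, φ c (spinRep t c (gen t x) z) = σ (gen t x) (φ c z))
    (hne : ∀ c, φ c (Pi.single (Fin.last c) 1) ≠ 0) :
    Function.Injective (LinearMap.lsum ℂ (fun c : S => Spin c) ℂ φ) := by
  have hli : LinearIndependent ℂ fun c : S => φ c (Pi.single (Fin.last c) 1) := by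
    refine Module.End.eigenvectors_linearIndependent' (σ (k t))
      (fun c : S => ((t : ℝ) : ℂ) ^ (c : ℤ)) (fun c d h => ?_) _ fun c => ?_
    · exact Subtype.ext (by exact_mod_cast zpow_injective ht h)
    · refine ⟨Module.End.mem_eigenspace_iff.2 ?_, hne c⟩
      rw [← hφ c Gen.k, spinRep_k_single, map_smul, Fin.val_last]
      congr 2
      ring
  -- Induction on `n`, where `x` is supported on the top `n` coordinates of each summand. Applying
  -- `e` shortens the support by one, so `e x = 0` by induction; then `x` is a combination of top
  -- vectors, whose images are independent.
  have key : ∀ (n : ℕ) (x : (c : S) → Spin c),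
      (∀ (c : S) (m : Fin (c + 1)), (m : ℕ) + n < c + 1 → x c m = 0) →
      ∑ c, φ c (x c) = 0 → x = 0 := by
    intro n
    induction n with
    | zero => intro x hx _; ext c m; exact hx c m m.2
    | succ n ih =>
      intro x hx h0
      have hE : (fun c : S => spinRep t c (e t) (x c)) = 0 := by
        refine ih _ (fun c m hm => ?_) ?_
        · obtain ⟨c, hc⟩ := c
          rw [spinRep_e]
          induction m using Fin.cases with
          | zero => exact matE_mulVec_zero _ _
          | succ i =>
            rw [matE_mulVec_succ, hx ⟨c, hc⟩ i.castSucc (by simp at hm ⊢; omega), mul_zero]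
        · simp only [hφ _ Gen.e, ← map_sum, h0, map_zero]
      have hx' : ∀ c : S, x c = x c (Fin.last c) • (Pi.single (Fin.last (c : ℕ)) 1 : Spin c) :=
        fun c => eq_smul_single_last_of_spinRep_e_eq_zero ht (congrFun hE c)
      have h1 : ∑ c : S, x c (Fin.last c) • φ c (Pi.single (Fin.last c) 1) = 0 := by
        rw [← h0]
        refine Finset.sum_congr rfl fun c _ => ?_
        rw [← map_smul, ← hx']
      ext1 c
      rw [hx', Fintype.linearIndependent_iff.1 hli _ h1 c, zero_smul, Pi.zero_apply]
  rw [← LinearMap.ker_eq_bot, LinearMap.ker_eq_bot']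
  intro x hx
  -- This `n` is at least every `c + 1`, so the support condition is vacuous.
  refine key (S.sup id + 1) x (fun c m hm => ?_) (by simpa using hx)
  have : (c : ℕ) ≤ S.sup id := Finset.le_sup (f := id) c.2
  omega

theorem exists_real_cgDecomposition (ht : (t : ℝ) ^ 2 ≠ 1) (a b : ℕ) :
    ∃ D : CGDecomposition t a b, ∀ (c : ℕ) (p : Fin (a + 1)) (n : Fin (b + 1))
      (m : Fin (c + 1)), (D.coeff c p n m).im = 0 := by
  choose v hv0 hve hvk hvr using fun c : cgSpins a b => exists_highestWeight ht c.2
  let σ := tensorRep (spinRep t a) (spinRep t b)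
  let φ (c : cgSpins a b) : Spin c →ₗ[ℂ] Spin a ⊗[ℂ] Spin b := highestWeightMap σ c (v c)
  have hφ (c : cgSpins a b) (x : Gen) (z : Spin c) :
      φ c (spinRep t c (gen t x) z) = σ (gen t x) (φ c z) :=
    highestWeightMap_intertwines ht (hve c) (hvk c) tensorRep_f_eq_zero x z
  let Φ := LinearMap.lsum ℂ (fun c : cgSpins a b => Spin c) ℂ φ
  have hΦ (y) : Φ y = ∑ c, φ c (y c) := by simp [Φ]
  have hinj : Function.Injective Φ := by
    refine sum_apply_injective ht φ hφ fun c => ?_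
    simpa only [φ, highestWeightMap_single, Fin.val_last, Nat.sub_self] using! hv0 c
  let Ψ := LinearMap.linearEquivOfInjective Φ hinj (finrank_pi_cgSpins a b)
  have hΨ (y) : Ψ y = Φ y := rfl
  refine ⟨⟨Ψ.symm, fun x w c => ?_⟩, fun c p n m => ?_⟩
  · obtain ⟨y, rfl⟩ := Ψ.surjective w
    rw [LinearEquiv.symm_apply_apply]
    have h : Ψ (fun d => spinRep t d x (y d)) =
        tensorRep (spinRep t a) (spinRep t b) x (Ψ y) := by
      rw [hΨ, hΨ, hΦ, hΦ, map_sum]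
      exact Finset.sum_congr rfl fun d _ => intertwines_of_gen (hφ d) x (y d)
    rw [← h, LinearEquiv.symm_apply_apply]
  · rw [CGDecomposition.coeff]
    split_ifs with hc
    · dsimp only
      generalize hy : Ψ.symm _ = y
      rw [LinearEquiv.symm_apply_eq, hΨ, hΦ] at hy
      -- `Φ` commutes with conjugation and `e_p ⊗ e_n` is real, so `y` and its conjugate have the
      -- same image under the injective `Φ`.
      have h : star y = y := by
        apply hinj
        apply (tensorCoords a b).injective
        rw [hΦ, hΦ, map_sum]
        simp only [Pi.star_apply, φ]
        rw [Finset.sum_congr rfl fun d _ => tensorCoords_highestWeightMap_star (hvr d) (y d),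
          ← star_sum, ← map_sum, ← hy]
        ext i
        simp only [tensorCoords_tmul, Pi.star_apply, Pi.single_apply]
        split_ifs <;> simp
      exact Complex.conj_eq_iff_im.1 (congrFun (congrFun h ⟨c, hc⟩) m)
    · rfl

end Usu2

/-! ### The Wigner–Eckart theorem with real reduced matrix elements -/

theorem theorem3 (t : ℝˣ) (ht : (t : ℝ) ^ 2 ≠ 1) (k l j : ℕ) :
    (∃ D : Usu2.CGDecomposition t k l, ∀ (i : ℕ) (p : Fin (k + 1)) (n : Fin (l + 1))
      (m : Fin (i + 1)), (D.coeff i p n m).im = 0) ∧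
    ∀ (D : Usu2.CGDecomposition t k l)
      (T : Usu2.Spin k →ₗ[ℂ] (Usu2.Spin l →ₗ[ℂ] Usu2.Spin j)),
      IsTensorOperator (Usu2.spinRep t k) (Usu2.spinRep t l) (Usu2.spinRep t j) T →
      ∃ α : ℂ,
        (∀ (p : Fin (k + 1)) (n : Fin (l + 1)) (m : Fin (j + 1)),
          LinearMap.toMatrix' (T (Pi.single p 1)) m n = α * D.coeff j p n m) ∧
        ((∀ (p : Fin (k + 1)) (n : Fin (l + 1)) (m : Fin (j + 1)),
            (D.coeff j p n m).im = 0 ∧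
              (LinearMap.toMatrix' (T (Pi.single p 1)) m n).im = 0) →
          α.im = 0) := by
  refine ⟨Usu2.exists_real_cgDecomposition ht k l, fun D T hT => ?_⟩
  obtain ⟨α, hα⟩ := D.exists_reduced_matrix_element ht hT
  -- If all coefficients vanish, `α` is undetermined and the real value `0` is chosen; otherwise,
  -- under the reality assumption, `α` is a quotient of two real numbers.
  by_cases h0 : ∀ p n m, D.coeff j p n m = 0
  · refine ⟨0, fun p n m => ?_, fun _ => rfl⟩
    rw [hα, h0, mul_zero, mul_zero]
  · push Not at h0
    obtain ⟨p, n, m, h⟩ := h0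
    refine ⟨α, hα, fun hr => ?_⟩
    obtain ⟨h1, h2⟩ := hr p n m
    rw [hα, Complex.mul_im, h1, mul_zero, zero_add] at h2
    refine (mul_eq_zero.1 h2).resolve_right fun h3 => h (Complex.ext h3 h1)
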